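/- **Setting.** Let $\mathcal X$ be a finite-dimensional real Euclidean space. For linear operators on $\mathcal X$ let $\langle \mathbf A,\mathbf B\rangle=\operatorname{tr}(\mathbf A\mathbf B^*)$, $\|\mathbf A\|_{\rm tr}=\operatorname{tr}\sqrt{\mathbf A\mathbf A^*}$, and let $\|\cdot\|_{\rm op}$ be the operator norm; $\mathbb S$ and $\mathbb S_{++}$ are the sets of self-adjoint and of self-adjoint positive definite operators, and $z\langle y,\cdot\rangle$ is the operator $x\mapsto\langle y,x\rangle z$. For $\mathbf H\in\mathbb S_{++}$ put $\|x\|_{\mathbf H}^2=\langle x,\mathbf Hx\rangle$. If $\mathbf H\in\mathbb S$ has distinct eigenvalues $\lambda_i$ and orthogonal projections $\mathbf P_i$ onto the eigenspaces, then $\psi(\mathbf H)=\sum_i\psi(\lambda_i)\mathbf P_i$. **Preconditioner space.** Call a linear subspace $\mathcal H$ of $\mathbb S$ *admissible* if (a) the $\langle\cdot,\cdot\rangle$-orthogonal projection $\operatorname{proj}_{\mathcal H}$ onto $\mathcal H$ maps $\mathbb S_{++}$ into $\mathbb S_{++}$, and (b) $\psi(\mathbf H)\in\mathcal H$ for every $\mathbf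 H\in\mathcal H$ and every function $\psi:\mathbb R\to\mathbb R$. For $x\in\mathcal X$ let $\mathcal R(x)=\|\operatorname{proj}_{\mathcal H}(x\langle x,\cdot\rangle)\|_{\rm op}^{1/2}$. **Objective.** Let $\mathcal H$ be admissible, and let $f:\mathcal X\to\mathbb R$ be convex with a minimizer $x^*$. Let $\nu\in[0,1]$ and $\mathbf L\in\mathcal H\cap\mathbb S_{++}$ be such that for all $x_1,x_2\in\mathcal X$ and all $v\in\partial f(x_1)$ $$0\le f(x_2)-f(x_1)-\langle v,x_2-x_1\rangle\le\tfrac1{1+\nu}\|\mathbf L\|_{\rm tr}^{\frac{1-\nu}2}\|x_2-x_1\|_{\mathbf L}^{1+\nu}.$$ **Stochastic gradients.** Let $\nabla f(x)\in\partial f(x)$ be a choice of subgradients, let $\mathcal D$ be a probability distribution, let $\nabla f(x;\xi)$ be jointly measurable in $(x,\xi)$, and put $n(x;\xi)=\nabla f(x;\xi)-\nabla f(x)$. Suppose that for some $\mathbf\Sigma\in\mathcal H\cap\mathbb S_{++}$ and all $x\in\mathcal X$ $$\mathbb E_{\xi\sim\mathcal D}[n(x;\xi)]=0,\qquad \mathbb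 E_{\xi\sim\mathcal D}\big[\|n(x;\xi)\|^2_{\mathbf\Sigma^{-1}}\big]\le\|\mathbf\Sigma\|_{\rm tr}.$$ **Algorithm.** Let $\delta,\eta>0$, $K\in\{1,2,\dots\}$ and $x_0\in\mathcal X$ be given. For $k=0,\dots,K$, with $\xi_0,\dots,\xi_K$ independent and distributed as $\mathcal D$, put $g_k=\nabla f(x_k;\xi_k)$, $\mathbf S_k=\sum_{i=0}^kg_i\langle g_i,\cdot\rangle$, $$\mathbf H_k=\operatorname*{argmin}_{\mathbf H\in\mathcal H\cap\mathbb S_{++}}\langle\mathbf H,\mathbf S_k\rangle+\langle\mathbf I,\phi(\mathbf H)\rangle,\quad\phi(h)=\delta h+\frac{\eta^2}h,\qquad x_{k+1}=\operatorname*{argmin}_{x\in\mathcal X}\ \langle g_k,x\rangle+\tfrac12\|x-x_k\|^2_{\mathbf H_k^{-1}},$$ and output $\overline x_K=\frac1{K+1}\sum_{k=0}^Kx_k$. **Theorem.** (1) Let $\eta=\mathcal R$, where $\mathcal R>0$ is a constant such that almost surely $\max_{k=0,\dots,K}\mathcal R(x_k-x^*)\le\mathcal R$. Then $f(\overline x_K)-f(x^*)$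 is integrable and $$\mathbb E[f(\overline x_K)-f(x^*)]\le\frac{3\|\mathbf L\|_{\rm tr}\mathcal R^{1+\nu}}{(K+1)^{\frac{1+\nu}2}}+\frac{3\|\mathbf\Sigma\|_{\rm tr}\mathcal R}{\sqrt{K+1}}+\frac{3\sqrt\delta\,\mathcal R\dim\mathcal X}{K+1}.$$ (2) The following spaces $\mathcal H$ are admissible, and with them the recursion for $x_{k+1}$ in the algorithm (for any $\delta,\eta>0$ and any $g_0,\dots,g_K$) is equivalent to the stated one: * AdaGrad-Norm: $\mathcal X=\mathbb R^d$, $\mathcal H=\{g\mapsto\beta g:\beta\in\mathbb R\}$, $\ x_{k+1}=x_k-\eta\big(\delta+\frac1d\sum_{i\le k}\|g_i\|^2\big)^{-1/2}g_k$; * AdaGrad: $\mathcal X=\mathbb R^d$, $\mathcal H=\{g\mapsto b\odot g:b\in\mathbb R^d\}$, $\ x_{k+1,j}=x_{k,j}-\eta\big(\delta+\sum_{i\le k}g_{i,j}^2\big)^{-1/2}g_{k,j}$; * ASGO/One-sided Shampoo: $\mathcal X=\mathbb R^{m\times n}$ (Frobenius inner product), $\mathcal H=\{G\mapsto BG:B\in\mathbb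 R^{m\times m}\text{ symmetric}\}$, $\ X_{k+1}=X_k-\eta\big(\delta I+\frac1n\sum_{i\le k}G_iG_i^\top\big)^{-1/2}G_k$; * DASGO: $\mathcal X=\mathbb R^{m\times n}$, $\mathcal H=\{G\mapsto\operatorname{diag}(b)G:b\in\mathbb R^m\}$, $\ (X_{k+1})_{pq}=(X_k)_{pq}-\eta\big(\delta+\frac1n\sum_{i\le k}\sum_s(G_i)_{ps}^2\big)^{-1/2}(G_k)_{pq}$. -/

import Mathlib

open MeasureTheory ProbabilityTheory

section Operators

variable {E : Type*} [NormedAddCommGroup E] [InnerProductSpace ℝ E] [FiniteDimensional ℝ E]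

/-- The inner product `⟨A, B⟩ = tr (A B*)` on the linear operators of a Euclidean space. -/
noncomputable def hsInner (A B : E →ₗ[ℝ] E) : ℝ :=
  LinearMap.trace ℝ E (A ∘ₗ LinearMap.adjoint B)

theorem hsInner_eq_sum (A B : E →ₗ[ℝ] E) :
    hsInner A B = ∑ i, inner ℝ (A (stdOrthonormalBasis ℝ E i)) (B (stdOrthonormalBasis ℝ E i)) := by
  rw [hsInner, LinearMap.trace_comp_comm',
    LinearMap.trace_eq_sum_inner _ (stdOrthonormalBasis ℝ E)]
  refine Finset.sum_congr rfl fun i _ => ?_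
  rw [LinearMap.comp_apply, LinearMap.adjoint_inner_right, real_inner_comm]

/-- `hsInner` is an inner product. -/
noncomputable abbrev hsCore : InnerProductSpace.Core ℝ (E →ₗ[ℝ] E) where
  inner := hsInner
  conj_inner_symm A B := by
    simp [hsInner_eq_sum, real_inner_comm]
  re_inner_nonneg A := by
    simp only [hsInner_eq_sum, RCLike.re_to_real]
    exact Finset.sum_nonneg fun i _ => real_inner_self_nonneg (F := E)
  add_left A B C := by
    simp [hsInner_eq_sum, inner_add_left, Finset.sum_add_distrib]
  smul_left A B r := by
    simp [hsInner_eq_sum, real_inner_smul_left, Finset.mul_sum]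
  definite A h := by
    change hsInner A A = 0 at h
    rw [hsInner_eq_sum,
      Finset.sum_eq_zero_iff_of_nonneg (fun i _ => real_inner_self_nonneg (F := E))] at h
    refine (stdOrthonormalBasis ℝ E).toBasis.ext fun i => ?_
    simpa using h i (Finset.mem_univ i)

/-- The orthogonal projection onto a space `𝓗` of operators, with respect to `hsInner`. -/
noncomputable def hsProj (𝓗 : Submodule ℝ (E →ₗ[ℝ] E)) (A : E →ₗ[ℝ] E) : E →ₗ[ℝ] E :=
  letI : NormedAddCommGroup (E →ₗ[ℝ] E) := hsCore.toNormedAddCommGroup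
  letI : InnerProductSpace ℝ (E →ₗ[ℝ] E) := InnerProductSpace.ofCore hsCore.toCore
  𝓗.starProjection A

theorem hsProj_mem (𝓗 : Submodule ℝ (E →ₗ[ℝ] E)) (A : E →ₗ[ℝ] E) : hsProj 𝓗 A ∈ 𝓗 := by
  let : NormedAddCommGroup (E →ₗ[ℝ] E) := hsCore.toNormedAddCommGroup
  let : InnerProductSpace ℝ (E →ₗ[ℝ] E) := InnerProductSpace.ofCore hsCore.toCore
  exact 𝓗.starProjection_apply_mem A

theorem hsInner_sub_hsProj (𝓗 : Submodule ℝ (E →ₗ[ℝ] E)) (A B : E →ₗ[ℝ] E) (hB : B ∈ 𝓗) :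
    hsInner (A - hsProj 𝓗 A) B = 0 := by
  let : NormedAddCommGroup (E →ₗ[ℝ] E) := hsCore.toNormedAddCommGroup
  let : InnerProductSpace ℝ (E →ₗ[ℝ] E) := InnerProductSpace.ofCore hsCore.toCore
  exact 𝓗.starProjection_inner_eq_zero A B hB

/-- Self-adjoint positive definite operators. -/
def IsPosDefOp (A : E →ₗ[ℝ] E) : Prop :=
  A.IsSymmetric ∧ ∀ x : E, x ≠ 0 → 0 < inner ℝ x (A x)

/-- The operator function `ψ(A) = ∑ ψ(λ) P_λ` of a self-adjoint operator `A`, where `λ` runs over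
the distinct eigenvalues of `A` and `P_λ` is the orthogonal projection onto the eigenspace. -/
noncomputable def opFun (ψ : ℝ → ℝ) (A : E →ₗ[ℝ] E) : E →ₗ[ℝ] E :=
  ∑ l : Module.End.Eigenvalues A,
    ψ l • ((Module.End.eigenspace A (l : ℝ)).starProjection : E →L[ℝ] E).toLinearMap

/-- The trace norm `tr √(A A*)`. -/
noncomputable def trNorm (A : E →ₗ[ℝ] E) : ℝ :=
  LinearMap.trace ℝ E (opFun Real.sqrt (A ∘ₗ LinearMap.adjoint A))

/-- The operator norm. -/
noncomputable def opNorm (A : E →ₗ[ℝ] E) : ℝ := ‖LinearMap.toContinuousLinearMap A‖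

/-- The squared weighted norm `‖x‖²_A = ⟨x, A x⟩`. -/
noncomputable def wNormSq (A : E →ₗ[ℝ] E) (x : E) : ℝ := inner ℝ x (A x)

/-- The weighted norm `‖x‖_A`. -/
noncomputable def wNorm (A : E →ₗ[ℝ] E) (x : E) : ℝ := √(wNormSq A x)

/-- The rank-one operator `z⟨y, ·⟩`. -/
noncomputable def rankOneOp (z y : E) : E →ₗ[ℝ] E :=
  (InnerProductSpace.rankOne ℝ z y : E →L[ℝ] E).toLinearMap

/-- A space of self-adjoint operators with an order-preserving projection that is closed under
operator functions. -/
structure IsPreconditionerSpace (𝓗 : Submodule ℝ (E →ₗ[ℝ] E)) : Prop where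
  isSymmetric : ∀ A ∈ 𝓗, A.IsSymmetric
  proj_posDef : ∀ A : E →ₗ[ℝ] E, IsPosDefOp A → IsPosDefOp (hsProj 𝓗 A)
  opFun_mem : ∀ ψ : ℝ → ℝ, ∀ A ∈ 𝓗, opFun ψ A ∈ 𝓗

/-- The norm `𝓡(x) = ‖proj_𝓗 (x⟨x, ·⟩)‖_op ^ (1/2)`. -/
noncomputable def precNorm (𝓗 : Submodule ℝ (E →ₗ[ℝ] E)) (x : E) : ℝ :=
  √(opNorm (hsProj 𝓗 (rankOneOp x x)))

/-- The potential function `φ(h) = δ h + η² / h`. -/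
noncomputable def potential (δ η h : ℝ) : ℝ := δ * h + η ^ 2 / h

/-- `H` is a solution of `min ⟨H, S⟩ + ⟨I, φ(H)⟩` over the positive definite elements of `𝓗`. -/
def IsPreconditioner (𝓗 : Submodule ℝ (E →ₗ[ℝ] E)) (δ η : ℝ) (S H : E →ₗ[ℝ] E) : Prop :=
  (H ∈ 𝓗 ∧ IsPosDefOp H) ∧
    ∀ H' ∈ 𝓗, IsPosDefOp H' →
      hsInner H S + hsInner LinearMap.id (opFun (potential δ η) H) ≤
        hsInner H' S + hsInner LinearMap.id (opFun (potential δ η) H')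

/-- `x'` is a solution of `min ⟨g, y⟩ + ½ ‖y - x‖²_{H⁻¹}` over all `y`. -/
def IsPrecondStep (H : E →ₗ[ℝ] E) (g x x' : E) : Prop :=
  ∀ y : E, inner ℝ g x' + 1 / 2 * wNormSq (Ring.inverse H) (x' - x) ≤
    inner ℝ g y + 1 / 2 * wNormSq (Ring.inverse H) (y - x)

/-- The steps `k = 0, …, K` of adaptive preconditioned SGD, with iterates `x k` and
(stochastic) gradients `g k`. -/
def IsAdaptiveRun (𝓗 : Submodule ℝ (E →ₗ[ℝ] E)) (δ η : ℝ) (K : ℕ) (x g : ℕ → E) : Prop :=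
  ∀ k ≤ K, ∃ H : E →ₗ[ℝ] E,
    IsPreconditioner 𝓗 δ η (∑ i ∈ Finset.range (k + 1), rankOneOp (g i) (g i)) H ∧
      IsPrecondStep H (g k) (x k) (x (k + 1))

/-- `v` is a subgradient of `f` at `x`. -/
def IsSubgradientAt (f : E → ℝ) (x v : E) : Prop :=
  ∀ y : E, f x + inner ℝ v (y - x) ≤ f y

/-- `f` is convex and `(‖L‖_tr ^ ((1 - ν) / 2), ν)`-Hölder smooth with respect to `‖·‖_L`. -/
def IsMatrixHolder (f : E → ℝ) (L : E →ₗ[ℝ] E) (ν : ℝ) : Prop :=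
  ConvexOn ℝ Set.univ f ∧
    ∀ x v : E, IsSubgradientAt f x v → ∀ y : E,
      0 ≤ f y - f x - inner ℝ v (y - x) ∧
        f y - f x - inner ℝ v (y - x) ≤
          1 / (1 + ν) * trNorm L ^ ((1 - ν) / 2) * wNorm L (y - x) ^ (1 + ν)

/-- `G x ζ` is an estimator of the subgradient `gradf x` whose noise has mean zero and variance
bounded through `Sig`. -/
def IsStochasticGradient [MeasurableSpace E] [BorelSpace E] {Z : Type*} [MeasurableSpace Z]
    (D : Measure Z) (gradf : E → E) (G : E → Z → E) (Sig : E →ₗ[ℝ] E) : Prop :=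
  Measurable (Function.uncurry G) ∧
    ∀ x : E,
      (Integrable (fun ζ => G x ζ - gradf x) D ∧ ∫ ζ, (G x ζ - gradf x) ∂D = 0) ∧
      (Integrable (fun ζ => wNormSq (Ring.inverse Sig) (G x ζ - gradf x)) D ∧
        ∫ ζ, wNormSq (Ring.inverse Sig) (G x ζ - gradf x) ∂D ≤ trNorm Sig)

end Operators

section Examples

/-- The multiples of the identity on `ℝ^d`. -/
noncomputable def adaGradNormSpace (d : ℕ) :
    Submodule ℝ (EuclideanSpace ℝ (Fin d) →ₗ[ℝ] EuclideanSpace ℝ (Fin d)) where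
  carrier := {T | ∃ β : ℝ, ∀ x, T x = β • x}
  zero_mem' := ⟨0, by simp⟩
  add_mem' := by
    rintro S T ⟨a, ha⟩ ⟨b, hb⟩
    exact ⟨a + b, fun x => by simp [ha, hb, add_smul]⟩
  smul_mem' := by
    rintro c T ⟨a, ha⟩
    exact ⟨c * a, fun x => by simp [ha, mul_smul]⟩

/-- The diagonal operators on `ℝ^d`. -/
noncomputable def adaGradSpace (d : ℕ) :
    Submodule ℝ (EuclideanSpace ℝ (Fin d) →ₗ[ℝ] EuclideanSpace ℝ (Fin d)) where
  carrier := {T | ∃ b : Fin d → ℝ, ∀ x j, T x j = b j * x j}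
  zero_mem' := ⟨0, by simp⟩
  add_mem' := by
    rintro S T ⟨a, ha⟩ ⟨b, hb⟩
    exact ⟨a + b, fun x j => by simp [ha, hb, add_mul]⟩
  smul_mem' := by
    rintro c T ⟨a, ha⟩
    exact ⟨c • a, fun x j => by simp [ha, mul_assoc]⟩

/-- The Euclidean (Frobenius) space of `m × n` matrices. -/
abbrev MatSpace (m n : ℕ) : Type := EuclideanSpace ℝ (Fin m × Fin n)

/-- An element of `MatSpace m n` as a matrix. -/
def MatSpace.mat {m n : ℕ} (x : MatSpace m n) : Matrix (Fin m) (Fin n) ℝ :=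
  Matrix.of fun i j => x (i, j)

theorem MatSpace.mat_add {m n : ℕ} (x y : MatSpace m n) : (x + y).mat = x.mat + y.mat := rfl

theorem MatSpace.mat_smul {m n : ℕ} (c : ℝ) (x : MatSpace m n) : (c • x).mat = c • x.mat := rfl

/-- The operators `G ↦ B G` with `B` symmetric. -/
noncomputable def asgoSpace (m n : ℕ) : Submodule ℝ (MatSpace m n →ₗ[ℝ] MatSpace m n) where
  carrier := {T | ∃ B : Matrix (Fin m) (Fin m) ℝ, B.IsSymm ∧ ∀ x, (T x).mat = B * x.mat}
  zero_mem' := ⟨0, Matrix.isSymm_zero, fun x => by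
    ext i j
    simp [MatSpace.mat]⟩
  add_mem' := by
    rintro S T ⟨A, hA, hSA⟩ ⟨B, hB, hTB⟩
    exact ⟨A + B, hA.add hB, fun x => by
      rw [LinearMap.add_apply, MatSpace.mat_add, hSA, hTB, Matrix.add_mul]⟩
  smul_mem' := by
    rintro c T ⟨A, hA, hTA⟩
    exact ⟨c • A, hA.smul c, fun x => by
      rw [LinearMap.smul_apply, MatSpace.mat_smul, hTA, Matrix.smul_mul]⟩

/-- The operators `G ↦ diag(b) G`. -/
noncomputable def dasgoSpace (m n : ℕ) : Submodule ℝ (MatSpace m n →ₗ[ℝ] MatSpace m n) where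
  carrier := {T | ∃ b : Fin m → ℝ, ∀ x, (T x).mat = Matrix.diagonal b * x.mat}
  zero_mem' := ⟨0, fun x => by
    ext i j
    simp [MatSpace.mat]⟩
  add_mem' := by
    rintro S T ⟨a, hSA⟩ ⟨b, hTB⟩
    exact ⟨a + b, fun x => by
      rw [LinearMap.add_apply, MatSpace.mat_add, hSA, hTB, ← Matrix.add_mul, Matrix.diagonal_add]
      rfl⟩
  smul_mem' := by
    rintro c T ⟨a, hTA⟩
    exact ⟨c • a, fun x => by
      rw [LinearMap.smul_apply, MatSpace.mat_smul, hTA, Matrix.diagonal_smul, Matrix.smul_mul]⟩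

/-- AdaGrad-Norm (with regularization `δ`). -/
def IsAdaGradNormRun {d : ℕ} (δ η : ℝ) (K : ℕ) (x g : ℕ → EuclideanSpace ℝ (Fin d)) : Prop :=
  ∀ k ≤ K, x (k + 1) =
    x k - (η / √(δ + 1 / (d : ℝ) * ∑ i ∈ Finset.range (k + 1), ‖g i‖ ^ 2)) • g k

/-- AdaGrad (with regularization `δ`). -/
def IsAdaGradRun {d : ℕ} (δ η : ℝ) (K : ℕ) (x g : ℕ → EuclideanSpace ℝ (Fin d)) : Prop :=
  ∀ k ≤ K, ∀ j, x (k + 1) j =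
    x k j - η / √(δ + ∑ i ∈ Finset.range (k + 1), g i j ^ 2) * g k j

/-- ASGO / One-sided Shampoo (with regularization `δ`); `cfc` applies the scalar function
`t ↦ t ^ (-1/2)` to the eigenvalues of a symmetric matrix. -/
noncomputable def IsASGORun {m n : ℕ} (δ η : ℝ) (K : ℕ) (x g : ℕ → MatSpace m n) : Prop :=
  ∀ k ≤ K, (x (k + 1)).mat =
    (x k).mat - η • (cfc (fun t : ℝ => (√t)⁻¹)
      (δ • (1 : Matrix (Fin m) (Fin m) ℝ) +
        (1 / (n : ℝ)) • ∑ i ∈ Finset.range (k + 1), (g i).mat * (g i).mat.transpose) *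
      (g k).mat)

/-- DASGO (with regularization `δ`). -/
def IsDASGORun {m n : ℕ} (δ η : ℝ) (K : ℕ) (x g : ℕ → MatSpace m n) : Prop :=
  ∀ k ≤ K, ∀ p q, (x (k + 1)).mat p q =
    (x k).mat p q -
      η / √(δ + 1 / (n : ℝ) * ∑ i ∈ Finset.range (k + 1), ∑ s, (g i).mat p s ^ 2) *
        (g k).mat p q

end Examples

/-! Write `A_n = δ I + proj_𝓗 (∑_{i<n} g_i⟨g_i, ·⟩)` (`gramOp`). On `𝓗`, pairing with `S` is the
same as pairing with its projection, so completing the square (`trace_mul_sq_add`) shows that the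
preconditioner is exactly `η A_{k+1}^{-1/2}`. The algorithm is thus the explicit recursion `x_{k+1}
= x_k - η A_{k+1}^{-1/2} g_k` (`IsPreconditionerSpace.isAdaptiveRun_iff`). The examples follow by
computing this operator; their admissibility follows because closure under operator functions alone
forces the projection to preserve positivity.

For the rate, expand `‖x_{k+1} - x*‖²` in the weight `A_{k+1}^{1/2}`. The weights increase by
operator monotonicity of the square root, stay in `𝓗`, and satisfy `⟨y, A y⟩ ≤ tr A · 𝓡(y)²`;
together with the concavity of `tr √` this gives `∑ ⟨g_k, x_k - x*⟩ ≤ (3/2) R tr A_{K+1}^{1/2}`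
(`sum_inner_le_trace`). The trace is then linearized: `2 tr A^{1/2} ≤ tr B + ⟨B⁻¹, A⟩` for any
positive definite `B` in `𝓗` (`two_mul_trace_sqrtOp_gramOp_le`). Taking `B` as a combination of `I`,
`L` and `Σ` splits the gradient norms into a smooth part and a noise part. The smooth part `∑
‖∇f(x_k)‖²_{L⁻¹}` is cancelled exactly by cocoercivity at the minimizer
(`IsMatrixHolder.le_inner_sub`), which gives a pathwise bound
(`IsPreconditionerSpace.sum_gap_add_noise_le`).

Finally, expectations are taken. Each `x_k` is a measurable function of the earlier samples, hence
independent of `ξ_k`, so the noise pairing has mean zero and the noise variance is at most `‖Σ‖_tr`.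
Measurability comes from continuity of `A ↦ A^{-1/2}` on operators bounded below by `δ`. Jensen's
inequality passes to the averaged iterate. -/

set_option linter.unusedSectionVars false

/-! ### Spectral calculus, traces and square roots of operators. -/

section Operators

variable {E : Type*} [NormedAddCommGroup E] [InnerProductSpace ℝ E] [FiniteDimensional ℝ E]

/-- Eigenspaces of a symmetric operator are orthogonal, so only the summand of the eigenvalue `l`
survives. Identities between operator functions can then be checked on an eigenbasis. -/
theorem opFun_apply_of_eigenvector {A : E →ₗ[ℝ] E} (hA : A.IsSymmetric) (ψ : ℝ → ℝ) {l : ℝ}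
    {v : E} (hv : A v = l • v) : opFun ψ A v = ψ l • v := by
  by_cases hv0 : v = 0
  · simp [hv0]
  have hmem : v ∈ Module.End.eigenspace A l := Module.End.mem_eigenspace_iff.2 hv
  have hl : Module.End.HasEigenvalue A l := Module.End.hasEigenvalue_of_hasEigenvector ⟨hmem, hv0⟩
  let μ : Module.End.Eigenvalues A := ⟨l, hl⟩
  refine (LinearMap.sum_apply _ _ _).trans ((Finset.sum_eq_single μ ?_
    fun h => absurd (Finset.mem_univ _) h).trans ?_)
  rotate_left
  · change ψ l • (Module.End.eigenspace A l).starProjection v = _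
    rw [Submodule.starProjection_eq_self_iff.2 hmem]
  · intro m _ hm
    have hne : l ≠ (m : ℝ) := fun h => hm (Subtype.ext h.symm)
    have h0 : (Module.End.eigenspace A (m : ℝ)).starProjection v = 0 := by
      refine Submodule.eq_starProjection_of_mem_of_inner_eq_zero (Submodule.zero_mem _) ?_
      intro w hw
      rw [sub_zero]
      exact hA.orthogonalFamily_eigenspaces hne ⟨v, hmem⟩ ⟨w, hw⟩
    change ψ m • (Module.End.eigenspace A (m : ℝ)).starProjection v = 0
    rw [h0, smul_zero]

theorem LinearMap.IsSymmetric.exists_eigenbasis {A : E →ₗ[ℝ] E} (hA : A.IsSymmetric) :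
    ∃ (b : OrthonormalBasis (Fin (Module.finrank ℝ E)) ℝ E) (l : Fin (Module.finrank ℝ E) → ℝ),
      ∀ i, A (b i) = l i • b i :=
  ⟨hA.eigenvectorBasis rfl, hA.eigenvalues rfl, hA.apply_eigenvectorBasis rfl⟩

section Basis

variable {ι : Type*} [Fintype ι] (b : OrthonormalBasis ι ℝ E)

theorem linearMap_ext_orthonormalBasis {S T : E →ₗ[ℝ] E} (h : ∀ i, S (b i) = T (b i)) : S = T :=
  b.toBasis.ext fun i => by simpa using h i

theorem inner_apply_eq_sum_of_eigenbasis {T : E →ₗ[ℝ] E} {t : ι → ℝ}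
    (h : ∀ i, T (b i) = t i • b i) (x y : E) :
    inner ℝ x (T y) = ∑ i, t i * (inner ℝ (b i) x * inner ℝ (b i) y) := by
  conv_lhs => rw [← b.sum_repr' y]
  simp only [map_sum, map_smul, h, inner_sum, real_inner_smul_right]
  refine Finset.sum_congr rfl fun i _ => ?_
  rw [real_inner_comm x]
  ring

theorem isSymmetric_of_eigenbasis {T : E →ₗ[ℝ] E} {t : ι → ℝ}
    (h : ∀ i, T (b i) = t i • b i) : T.IsSymmetric := by
  intro x y
  rw [real_inner_comm, inner_apply_eq_sum_of_eigenbasis b h, inner_apply_eq_sum_of_eigenbasis b h]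
  exact Finset.sum_congr rfl fun i _ => by ring

theorem isPosDefOp_of_eigenbasis {T : E →ₗ[ℝ] E} {t : ι → ℝ}
    (h : ∀ i, T (b i) = t i • b i) (ht : ∀ i, 0 < t i) : IsPosDefOp T := by
  refine ⟨isSymmetric_of_eigenbasis b h, fun x hx => ?_⟩
  rw [inner_apply_eq_sum_of_eigenbasis b h]
  have hne : ∃ i, inner ℝ (b i) x ≠ 0 := by
    by_contra! h0
    apply hx
    rw [← b.sum_repr' x]
    simp [h0]
  obtain ⟨i, hi⟩ := hne
  refine Finset.sum_pos' (fun j _ => mul_nonneg (ht j).le (mul_self_nonneg _))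
    ⟨i, Finset.mem_univ i, mul_pos (ht i) (mul_self_pos.2 hi)⟩

theorem opFun_apply_eigenbasis {A : E →ₗ[ℝ] E} {t : ι → ℝ}
    (h : ∀ i, A (b i) = t i • b i) (ψ : ℝ → ℝ) (i : ι) : opFun ψ A (b i) = ψ (t i) • b i :=
  opFun_apply_of_eigenvector (isSymmetric_of_eigenbasis b h) ψ (h i)

theorem trace_eq_sum_of_eigenbasis {A : E →ₗ[ℝ] E} {t : ι → ℝ}
    (h : ∀ i, A (b i) = t i • b i) : LinearMap.trace ℝ E A = ∑ i, t i := by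
  rw [LinearMap.trace_eq_sum_inner _ b]
  simp [h, real_inner_smul_right]

end Basis

/-- Positive semidefinite operators, in the form of quadratic forms. -/
def IsPosSemidefOp (A : E →ₗ[ℝ] E) : Prop :=
  A.IsSymmetric ∧ ∀ x : E, 0 ≤ inner ℝ x (A x)

theorem IsPosDefOp.posSemidef {A : E →ₗ[ℝ] E} (hA : IsPosDefOp A) : IsPosSemidefOp A :=
  ⟨hA.1, fun x => by
    by_cases hx : x = 0
    · simp [hx]
    · exact (hA.2 x hx).le⟩

theorem IsPosDefOp.eigenvalue_pos {A : E →ₗ[ℝ] E} (hA : IsPosDefOp A) {l : ℝ} {v : E}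
    (hv : A v = l • v) (hv0 : v ≠ 0) : 0 < l := by
  have h := hA.2 v hv0
  rw [hv, real_inner_smul_right] at h
  exact pos_of_mul_pos_left h real_inner_self_nonneg

theorem IsPosSemidefOp.eigenvalue_nonneg {A : E →ₗ[ℝ] E} (hA : IsPosSemidefOp A) {l : ℝ} {v : E}
    (hv : A v = l • v) (hv0 : v ≠ 0) : 0 ≤ l := by
  have h := hA.2 v
  rw [hv, real_inner_smul_right] at h
  exact nonneg_of_mul_nonneg_left h (real_inner_self_pos.2 hv0)

theorem IsPosDefOp.exists_eigenbasis {A : E →ₗ[ℝ] E} (hA : IsPosDefOp A) :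
    ∃ (b : OrthonormalBasis (Fin (Module.finrank ℝ E)) ℝ E) (l : Fin (Module.finrank ℝ E) → ℝ),
      (∀ i, A (b i) = l i • b i) ∧ ∀ i, 0 < l i := by
  obtain ⟨b, l, h⟩ := hA.1.exists_eigenbasis
  exact ⟨b, l, h, fun i => hA.eigenvalue_pos (h i) (b.orthonormal.ne_zero i)⟩

theorem IsPosSemidefOp.exists_eigenbasis {A : E →ₗ[ℝ] E} (hA : IsPosSemidefOp A) :
    ∃ (b : OrthonormalBasis (Fin (Module.finrank ℝ E)) ℝ E) (l : Fin (Module.finrank ℝ E) → ℝ),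
      (∀ i, A (b i) = l i • b i) ∧ ∀ i, 0 ≤ l i := by
  obtain ⟨b, l, h⟩ := hA.1.exists_eigenbasis
  exact ⟨b, l, h, fun i => hA.eigenvalue_nonneg (h i) (b.orthonormal.ne_zero i)⟩

theorem IsPosDefOp.map_opFun {A : E →ₗ[ℝ] E} (hA : IsPosDefOp A) {ψ : ℝ → ℝ}
    (hψ : ∀ t, 0 < t → 0 < ψ t) : IsPosDefOp (opFun ψ A) := by
  obtain ⟨b, l, h, hl⟩ := hA.exists_eigenbasis
  exact isPosDefOp_of_eigenbasis b (opFun_apply_eigenbasis b h ψ) fun i => hψ _ (hl i)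

theorem isPosDefOp_id : IsPosDefOp (LinearMap.id : E →ₗ[ℝ] E) :=
  ⟨fun _ _ => rfl, fun _ hx => real_inner_self_pos.2 hx⟩

theorem IsPosDefOp.smul {A : E →ₗ[ℝ] E} (hA : IsPosDefOp A) {c : ℝ} (hc : 0 < c) :
    IsPosDefOp (c • A) :=
  ⟨hA.1.smul (by simp), fun x hx => by
    rw [LinearMap.smul_apply, real_inner_smul_right]
    exact mul_pos hc (hA.2 x hx)⟩

theorem IsPosDefOp.add_posSemidef {A B : E →ₗ[ℝ] E} (hA : IsPosDefOp A) (hB : IsPosSemidefOp B) :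
    IsPosDefOp (A + B) :=
  ⟨hA.1.add hB.1, fun x hx => by
    rw [LinearMap.add_apply, inner_add_right]
    exact add_pos_of_pos_of_nonneg (hA.2 x hx) (hB.2 x)⟩

/-! ### Inverses and square roots -/

theorem IsPosDefOp.isUnit {A : E →ₗ[ℝ] E} (hA : IsPosDefOp A) : IsUnit A := by
  rw [LinearMap.isUnit_iff_ker_eq_bot, LinearMap.ker_eq_bot']
  intro x hx
  by_contra h0
  have := hA.2 x h0
  simp [hx] at this

theorem IsPosDefOp.apply_inverse {A : E →ₗ[ℝ] E} (hA : IsPosDefOp A) (x : E) :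
    A (Ring.inverse A x) = x := by
  have := Ring.mul_inverse_cancel A hA.isUnit
  exact LinearMap.congr_fun this x

theorem IsPosDefOp.inverse_apply {A : E →ₗ[ℝ] E} (hA : IsPosDefOp A) (x : E) :
    Ring.inverse A (A x) = x := by
  have := Ring.inverse_mul_cancel A hA.isUnit
  exact LinearMap.congr_fun this x

/-- This puts inverses within reach of the closure of `𝓗` under operator functions. -/
theorem IsPosDefOp.inverse_eq_opFun {A : E →ₗ[ℝ] E} (hA : IsPosDefOp A) :
    Ring.inverse A = opFun (fun t => t⁻¹) A := by
  obtain ⟨b, l, h, hl⟩ := hA.exists_eigenbasis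
  refine linearMap_ext_orthonormalBasis b fun i => ?_
  rw [opFun_apply_eigenbasis b h]
  have : A ((l i)⁻¹ • b i) = b i := by
    rw [map_smul, h, smul_smul, inv_mul_cancel₀ (hl i).ne', one_smul]
  conv_lhs => rw [← this]
  rw [hA.inverse_apply]

theorem IsPosDefOp.inverse {A : E →ₗ[ℝ] E} (hA : IsPosDefOp A) : IsPosDefOp (Ring.inverse A) := by
  rw [hA.inverse_eq_opFun]
  exact hA.map_opFun fun t => inv_pos.2

/-- The inverse square root of a positive definite operator. -/
noncomputable def invSqrtOp (A : E →ₗ[ℝ] E) : E →ₗ[ℝ] E := opFun (fun t => (√t)⁻¹) A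

/-- The square root of a positive definite operator. -/
noncomputable def sqrtOp (A : E →ₗ[ℝ] E) : E →ₗ[ℝ] E := opFun Real.sqrt A

theorem IsPosDefOp.sqrt {A : E →ₗ[ℝ] E} (hA : IsPosDefOp A) : IsPosDefOp (sqrtOp A) :=
  hA.map_opFun fun _ => Real.sqrt_pos.2

theorem IsPosDefOp.invSqrt {A : E →ₗ[ℝ] E} (hA : IsPosDefOp A) : IsPosDefOp (invSqrtOp A) :=
  hA.map_opFun fun _ ht => inv_pos.2 (Real.sqrt_pos.2 ht)

theorem IsPosDefOp.sqrtOp_mul_self {A : E →ₗ[ℝ] E} (hA : IsPosDefOp A) :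
    sqrtOp A * sqrtOp A = A := by
  obtain ⟨b, l, h, hl⟩ := hA.exists_eigenbasis
  refine linearMap_ext_orthonormalBasis b fun i => ?_
  rw [Module.End.mul_apply, sqrtOp, opFun_apply_eigenbasis b h, map_smul,
    opFun_apply_eigenbasis b h, smul_smul, Real.mul_self_sqrt (hl i).le, h]

theorem sqrtOp_mul_self_of_posDef {T : E →ₗ[ℝ] E} (hT : IsPosDefOp T) : sqrtOp (T * T) = T := by
  obtain ⟨b, l, h, hl⟩ := hT.exists_eigenbasis
  refine linearMap_ext_orthonormalBasis b fun i => ?_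
  have h2 : ∀ i, (T * T) (b i) = (l i * l i) • b i := fun i => by
    rw [Module.End.mul_apply, h, map_smul, h, smul_smul]
  rw [sqrtOp, opFun_apply_eigenbasis b h2, Real.sqrt_mul_self (hl i).le, h]

theorem IsPosDefOp.inverse_sqrtOp {A : E →ₗ[ℝ] E} (hA : IsPosDefOp A) :
    Ring.inverse (sqrtOp A) = invSqrtOp A := by
  obtain ⟨b, l, h, hl⟩ := hA.exists_eigenbasis
  refine linearMap_ext_orthonormalBasis b fun i => ?_
  have hs : ∀ i, sqrtOp A (b i) = √(l i) • b i := opFun_apply_eigenbasis b h _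
  rw [hA.sqrt.inverse_eq_opFun, opFun_apply_eigenbasis b hs, invSqrtOp,
    opFun_apply_eigenbasis b h]

theorem trNorm_of_posDef {A : E →ₗ[ℝ] E} (hA : IsPosDefOp A) :
    trNorm A = LinearMap.trace ℝ E A := by
  have h : LinearMap.adjoint A = A := hA.1.adjoint_eq
  rw [trNorm, h]
  exact congrArg _ (sqrtOp_mul_self_of_posDef hA)

/-! ### Traces -/

theorem hsInner_of_isSymmetric {A B : E →ₗ[ℝ] E} (hB : B.IsSymmetric) :
    hsInner A B = LinearMap.trace ℝ E (A * B) := by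
  rw [hsInner, hB.adjoint_eq]
  rfl

theorem hsInner_comm (A B : E →ₗ[ℝ] E) : hsInner A B = hsInner B A := by
  simp [hsInner_eq_sum, real_inner_comm]

theorem hsInner_add_right (A B C : E →ₗ[ℝ] E) : hsInner A (B + C) = hsInner A B + hsInner A C := by
  simp [hsInner_eq_sum, inner_add_right, Finset.sum_add_distrib]

theorem hsInner_sub_left (A B C : E →ₗ[ℝ] E) : hsInner (A - B) C = hsInner A C - hsInner B C := by
  simp [hsInner_eq_sum, inner_sub_left, Finset.sum_sub_distrib]

theorem hsInner_sub_right (A B C : E →ₗ[ℝ] E) : hsInner A (B - C) = hsInner A B - hsInner A C := by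
  simp [hsInner_eq_sum, inner_sub_right, Finset.sum_sub_distrib]

theorem hsInner_smul_left (c : ℝ) (A B : E →ₗ[ℝ] E) : hsInner (c • A) B = c * hsInner A B := by
  simp [hsInner_eq_sum, real_inner_smul_left, Finset.mul_sum]

theorem hsInner_smul_right (c : ℝ) (A B : E →ₗ[ℝ] E) : hsInner A (c • B) = c * hsInner A B := by
  simp [hsInner_eq_sum, real_inner_smul_right, Finset.mul_sum]

theorem hsInner_sum_right {ι : Type*} (s : Finset ι) (A : E →ₗ[ℝ] E) (B : ι → E →ₗ[ℝ] E) :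
    hsInner A (∑ i ∈ s, B i) = ∑ i ∈ s, hsInner A (B i) := by
  simp only [hsInner_eq_sum, LinearMap.sum_apply, inner_sum]
  exact Finset.sum_comm

theorem hsInner_id_left {A : E →ₗ[ℝ] E} : hsInner LinearMap.id A = LinearMap.trace ℝ E A := by
  rw [hsInner_comm, hsInner, LinearMap.adjoint_id, LinearMap.comp_id]

theorem hsInner_eq_sum_basis {ι : Type*} [Fintype ι] (b : OrthonormalBasis ι ℝ E)
    (A B : E →ₗ[ℝ] E) : hsInner A B = ∑ i, inner ℝ (A (b i)) (B (b i)) := by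
  rw [hsInner, LinearMap.trace_comp_comm', LinearMap.trace_eq_sum_inner _ b]
  refine Finset.sum_congr rfl fun i _ => ?_
  rw [LinearMap.comp_apply, LinearMap.adjoint_inner_right, real_inner_comm]

theorem rankOneOp_apply (z y x : E) : rankOneOp z y x = inner ℝ y x • z := rfl

theorem isPosSemidefOp_rankOneOp (x : E) : IsPosSemidefOp (rankOneOp x x) := by
  refine ⟨fun y z => ?_, fun y => ?_⟩
  · rw [rankOneOp_apply, rankOneOp_apply, real_inner_smul_left, real_inner_smul_right,
      real_inner_comm x y]
    ring
  · rw [rankOneOp_apply, real_inner_smul_right, real_inner_comm]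
    exact mul_self_nonneg _

theorem hsInner_rankOneOp (A : E →ₗ[ℝ] E) (x : E) :
    hsInner A (rankOneOp x x) = inner ℝ x (A x) := by
  rw [hsInner_eq_sum]
  conv_rhs => rw [← (stdOrthonormalBasis ℝ E).sum_repr' x]
  rw [map_sum, inner_sum]
  refine Finset.sum_congr rfl fun i _ => ?_
  rw [(stdOrthonormalBasis ℝ E).sum_repr' x, rankOneOp_apply, real_inner_smul_right, map_smul,
    real_inner_smul_right, real_inner_comm x, real_inner_comm (A _),
    real_inner_comm x (stdOrthonormalBasis ℝ E i)]

theorem trace_nonneg_of_posSemidef {A : E →ₗ[ℝ] E} (hA : IsPosSemidefOp A) :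
    0 ≤ LinearMap.trace ℝ E A := by
  rw [LinearMap.trace_eq_sum_inner _ (stdOrthonormalBasis ℝ E)]
  exact Finset.sum_nonneg fun i _ => hA.2 _

theorem hsInner_mul_self_nonneg {A : E →ₗ[ℝ] E} (hA : IsPosSemidefOp A) (M : E →ₗ[ℝ] E) :
    0 ≤ hsInner M (A * M) := by
  rw [hsInner_eq_sum]
  exact Finset.sum_nonneg fun i _ => hA.2 _

theorem eq_zero_of_hsInner_mul_self {A : E →ₗ[ℝ] E} (hA : IsPosDefOp A) {M : E →ₗ[ℝ] E}
    (h : hsInner M (A * M) = 0) : M = 0 := by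
  rw [hsInner_eq_sum] at h
  simp only [Module.End.mul_apply] at h
  rw [Finset.sum_eq_zero_iff_of_nonneg
    (fun i _ => hA.posSemidef.2 (M (stdOrthonormalBasis ℝ E i)))] at h
  refine linearMap_ext_orthonormalBasis (stdOrthonormalBasis ℝ E) fun i => ?_
  by_contra h0
  exact (hA.2 _ h0).ne' (h i (Finset.mem_univ i))

/-- Completion of the square for the trace objective of the preconditioner. -/
theorem trace_mul_sq_add {H Q : E →ₗ[ℝ] E} (hH : IsPosDefOp H) (hQ : Q.IsSymmetric) (η : ℝ) :
    hsInner H (Q * Q) + η ^ 2 * LinearMap.trace ℝ E (Ring.inverse H) =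
      2 * η * LinearMap.trace ℝ E Q +
        hsInner (H * Q - η • 1) (Ring.inverse H * (H * Q - η • 1)) := by
  have e : Ring.inverse H * (H * Q - η • 1) = Q - η • Ring.inverse H := by
    rw [mul_sub, ← mul_assoc, Ring.inverse_mul_cancel _ hH.isUnit, one_mul, mul_smul_comm, mul_one]
  have e1 : hsInner (H * Q) Q = hsInner H (Q * Q) := by
    have hQQ : (Q * Q).IsSymmetric := fun x y => by
      simp only [Module.End.mul_apply]
      rw [hQ, hQ]
    rw [hsInner_of_isSymmetric hQ, hsInner_of_isSymmetric hQQ, mul_assoc]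
  have e2 : hsInner (H * Q) (Ring.inverse H) = LinearMap.trace ℝ E Q := by
    rw [hsInner_of_isSymmetric hH.inverse.1, LinearMap.trace_mul_comm, ← mul_assoc,
      Ring.inverse_mul_cancel _ hH.isUnit, one_mul]
  have e3 (A : E →ₗ[ℝ] E) : hsInner (1 : E →ₗ[ℝ] E) A = LinearMap.trace ℝ E A := hsInner_id_left
  rw [e, hsInner_sub_left, hsInner_sub_right, hsInner_sub_right, hsInner_smul_right,
    hsInner_smul_right, hsInner_smul_left, hsInner_smul_left, e1, e2, e3, e3]
  ring

/-- A Young inequality for traces, obtained by dropping the square. It yields both the concavity of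
`tr √` and the linearization of the regret by a comparison operator. -/
theorem two_mul_trace_le {H Q : E →ₗ[ℝ] E} (hH : IsPosDefOp H) (hQ : Q.IsSymmetric) (η : ℝ) :
    2 * η * LinearMap.trace ℝ E Q ≤
      hsInner H (Q * Q) + η ^ 2 * LinearMap.trace ℝ E (Ring.inverse H) := by
  rw [trace_mul_sq_add hH hQ η]
  linarith [hsInner_mul_self_nonneg hH.inverse.posSemidef (H * Q - η • 1)]

/-! ### Monotonicity and continuity of the square root -/

/-- `P² - Q²` is the symmetrized product of `P - Q` and `P + Q`, so on an eigenvector of `P - Q` the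
quadratic form factors although `P` and `Q` need not commute. Monotonicity and continuity of the
square root both rest on this. -/
theorem inner_sq_sub_sq_of_eigenvector {P Q : E →ₗ[ℝ] E} (hP : P.IsSymmetric) (hQ : Q.IsSymmetric)
    {m : ℝ} {v : E} (hv : (P - Q) v = m • v) :
    inner ℝ v ((P * P - Q * Q) v) = m * inner ℝ v ((P + Q) v) := by
  have hP' : P v = Q v + m • v := by
    rw [← hv, LinearMap.sub_apply]
    abel
  simp only [LinearMap.sub_apply, LinearMap.add_apply, Module.End.mul_apply, inner_sub_right]
  rw [← hP v, ← hQ v, hP']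
  simp only [inner_add_left, inner_add_right, real_inner_smul_left, real_inner_smul_right]
  rw [real_inner_comm (Q v) v]
  ring

/-- Operator monotonicity of the square root: each eigenvalue of `P - Q`, multiplied by a positive
value of the form of `P + Q`, is nonnegative. -/
theorem sub_posSemidef_of_sq {P Q : E →ₗ[ℝ] E} (hP : IsPosDefOp P) (hQ : IsPosDefOp Q)
    (h : ∀ x, 0 ≤ inner ℝ x ((P * P - Q * Q) x)) : IsPosSemidefOp (P - Q) := by
  have hs : (P - Q).IsSymmetric := hP.1.sub hQ.1
  obtain ⟨b, l, hb⟩ := hs.exists_eigenbasis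
  refine ⟨hs, fun x => ?_⟩
  rw [inner_apply_eq_sum_of_eigenbasis b hb]
  refine Finset.sum_nonneg fun i _ => mul_nonneg ?_ (mul_self_nonneg _)
  have h1 := h (b i)
  rw [inner_sq_sub_sq_of_eigenvector hP.1 hQ.1 (hb i)] at h1
  exact nonneg_of_mul_nonneg_left h1
    ((hP.add_posSemidef hQ.posSemidef).2 _ (b.orthonormal.ne_zero i))

theorem norm_apply_le_of_eigenvalues {ι : Type*} [Fintype ι] (b : OrthonormalBasis ι ℝ E)
    {T : E →ₗ[ℝ] E} {t : ι → ℝ} (h : ∀ i, T (b i) = t i • b i) {M : ℝ} (hM : 0 ≤ M)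
    (ht : ∀ i, |t i| ≤ M) (x : E) : ‖T x‖ ≤ M * ‖x‖ := by
  refine abs_le_of_sq_le_sq' ?_ (by positivity) |>.2
  rw [mul_pow, ← b.sum_sq_norm_inner_right, ← b.sum_sq_norm_inner_right x, Finset.mul_sum]
  refine Finset.sum_le_sum fun i _ => ?_
  have hs := isSymmetric_of_eigenbasis b h
  rw [← hs, h, real_inner_smul_left, norm_mul, mul_pow]
  gcongr
  exact ht i

/-- The square root is Lipschitz away from zero: the form of `P + Q` is at least `2 s` on unit
vectors, which bounds every eigenvalue of `P - Q`. This is needed only for measurability of the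
iterates. -/
theorem norm_sub_apply_le_of_sq {P Q : E →ₗ[ℝ] E} (hP : P.IsSymmetric) (hQ : Q.IsSymmetric)
    {s : ℝ} (hs : 0 < s) (hPs : ∀ x, s * ‖x‖ ^ 2 ≤ inner ℝ x (P x))
    (hQs : ∀ x, s * ‖x‖ ^ 2 ≤ inner ℝ x (Q x)) (x : E) :
    ‖(P - Q) x‖ ≤ opNorm (P * P - Q * Q) / (2 * s) * ‖x‖ := by
  obtain ⟨b, l, hb⟩ := (hP.sub hQ).exists_eigenbasis
  have h0 : 0 ≤ opNorm (P * P - Q * Q) := norm_nonneg _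
  refine norm_apply_le_of_eigenvalues b hb (by positivity) (fun i => ?_) x
  rw [le_div_iff₀ (by positivity)]
  have h1 := inner_sq_sub_sq_of_eigenvector hP hQ (hb i)
  have hn : ‖b i‖ = 1 := b.orthonormal.1 i
  have h2 : 2 * s ≤ inner ℝ (b i) ((P + Q) (b i)) := by
    have := hPs (b i)
    have := hQs (b i)
    simp only [hn] at *
    rw [LinearMap.add_apply, inner_add_right]
    linarith
  have h3 : |inner ℝ (b i) ((P * P - Q * Q) (b i))| ≤ opNorm (P * P - Q * Q) := by
    refine (abs_real_inner_le_norm _ _).trans ?_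
    have := (LinearMap.toContinuousLinearMap (P * P - Q * Q)).le_opNorm (b i)
    rw [hn] at this ⊢
    simpa [opNorm] using this
  rw [h1, abs_mul, abs_of_pos (lt_of_lt_of_le (by positivity) h2)] at h3
  exact (mul_le_mul_of_nonneg_left h2 (abs_nonneg _)).trans h3

end Operators

/-! ### The projection onto `𝓗` and the closed form of the algorithm. -/

section Operators

variable {E : Type*} [NormedAddCommGroup E] [InnerProductSpace ℝ E] [FiniteDimensional ℝ E]

/-! ### Projections onto spaces of preconditioners -/

theorem hsProj_eq_of_mem {𝓗 : Submodule ℝ (E →ₗ[ℝ] E)} {A P : E →ₗ[ℝ] E} (hP : P ∈ 𝓗)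
    (h : ∀ B ∈ 𝓗, hsInner A B = hsInner P B) : hsProj 𝓗 A = P := by
  let : NormedAddCommGroup (E →ₗ[ℝ] E) := hsCore.toNormedAddCommGroup
  let : InnerProductSpace ℝ (E →ₗ[ℝ] E) := InnerProductSpace.ofCore hsCore.toCore
  refine Submodule.eq_starProjection_of_mem_of_inner_eq_zero hP fun B hB => ?_
  change hsInner (A - P) B = 0
  rw [hsInner_sub_left, h B hB, sub_self]

theorem hsInner_hsProj {𝓗 : Submodule ℝ (E →ₗ[ℝ] E)} (A : E →ₗ[ℝ] E) {B : E →ₗ[ℝ] E}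
    (hB : B ∈ 𝓗) : hsInner B (hsProj 𝓗 A) = hsInner B A := by
  have h := hsInner_sub_hsProj 𝓗 A B hB
  rw [hsInner_sub_left, sub_eq_zero] at h
  rw [hsInner_comm, ← h, hsInner_comm]

theorem hsProj_add (𝓗 : Submodule ℝ (E →ₗ[ℝ] E)) (A B : E →ₗ[ℝ] E) :
    hsProj 𝓗 (A + B) = hsProj 𝓗 A + hsProj 𝓗 B :=
  hsProj_eq_of_mem (𝓗.add_mem (hsProj_mem 𝓗 A) (hsProj_mem 𝓗 B)) fun C hC => by
    simp only [hsInner_comm _ C, hsInner_add_right, hsInner_hsProj _ hC]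

theorem hsProj_smul (𝓗 : Submodule ℝ (E →ₗ[ℝ] E)) (c : ℝ) (A : E →ₗ[ℝ] E) :
    hsProj 𝓗 (c • A) = c • hsProj 𝓗 A :=
  hsProj_eq_of_mem (𝓗.smul_mem c (hsProj_mem 𝓗 A)) fun C hC => by
    simp only [hsInner_comm _ C, hsInner_smul_right, hsInner_hsProj _ hC]

/-- `hsProj` as a linear map. -/
noncomputable def hsProjₗ (𝓗 : Submodule ℝ (E →ₗ[ℝ] E)) : (E →ₗ[ℝ] E) →ₗ[ℝ] (E →ₗ[ℝ] E) where
  toFun := hsProj 𝓗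
  map_add' := hsProj_add 𝓗
  map_smul' := hsProj_smul 𝓗

theorem hsProj_sum {ι : Type*} (𝓗 : Submodule ℝ (E →ₗ[ℝ] E)) (s : Finset ι)
    (A : ι → E →ₗ[ℝ] E) : hsProj 𝓗 (∑ i ∈ s, A i) = ∑ i ∈ s, hsProj 𝓗 (A i) :=
  map_sum (hsProjₗ 𝓗) A s

/-- Every eigenvalue of the projection of `A` is bounded below by a value of the quadratic form of
`A` on a nonzero vector. -/
theorem exists_inner_le_eigenvalue_hsProj {𝓗 : Submodule ℝ (E →ₗ[ℝ] E)}
    (hop : ∀ ψ : ℝ → ℝ, ∀ A ∈ 𝓗, opFun ψ A ∈ 𝓗) (A : E →ₗ[ℝ] E) {ι : Type*} [Fintype ι]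
    (b : OrthonormalBasis ι ℝ E) {l : ι → ℝ} (h : ∀ i, hsProj 𝓗 A (b i) = l i • b i) (i : ι) :
    ∃ j, inner ℝ (b j) (A (b j)) ≤ l i := by
  classical
  by_contra! hlt
  set P := hsProj 𝓗 A with hP
  -- With this `ψ`, `opFun ψ P` is the spectral projection of `P` for the eigenvalue `l i`. It lies
  -- in `𝓗`, so its pairings with `A` and with `P` agree; averaging over the eigenspace excludes
  -- that all values of the form of `A` there exceed `l i`.
  let ψ : ℝ → ℝ := fun t => if t = l i then 1 else 0
  have hE : opFun ψ P ∈ 𝓗 := hop ψ P (hsProj_mem 𝓗 A)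
  have h1 := hsInner_hsProj A hE
  rw [hsInner_eq_sum_basis b, hsInner_eq_sum_basis b, ← sub_eq_zero, ← Finset.sum_sub_distrib] at h1
  have hneg : ∑ j, (inner ℝ (opFun ψ P (b j)) (hsProj 𝓗 A (b j)) -
      inner ℝ (opFun ψ P (b j)) (A (b j))) < 0 := by
    have key : ∀ j, inner ℝ (opFun ψ P (b j)) (hsProj 𝓗 A (b j)) -
        inner ℝ (opFun ψ P (b j)) (A (b j)) =
        if l j = l i then l i - inner ℝ (b j) (A (b j)) else 0 := by
      intro j
      rw [opFun_apply_eigenbasis b h, ← hP, h, real_inner_smul_left, real_inner_smul_left,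
        real_inner_smul_right, real_inner_self_eq_norm_sq, b.orthonormal.1 j]
      simp only [ψ]
      split_ifs with hj
      · rw [hj]; ring
      · ring
    simp only [key]
    refine Finset.sum_neg' (fun j _ => ?_) ⟨i, Finset.mem_univ i, ?_⟩
    · split_ifs with hj
      · linarith [hlt j]
      · exact le_rfl
    · simpa using hlt i
  exact hneg.ne h1

/-- Positivity of the projection comes for free from spectral closure, so the examples only have to
verify symmetry and closure. -/
theorem isPreconditionerSpace_of_opFun_mem {𝓗 : Submodule ℝ (E →ₗ[ℝ] E)}
    (hs : ∀ A ∈ 𝓗, A.IsSymmetric) (hop : ∀ ψ : ℝ → ℝ, ∀ A ∈ 𝓗, opFun ψ A ∈ 𝓗) :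
    IsPreconditionerSpace 𝓗 where
  isSymmetric := hs
  opFun_mem := hop
  proj_posDef A hA := by
    obtain ⟨b, l, h⟩ := (hs _ (hsProj_mem 𝓗 A)).exists_eigenbasis
    refine isPosDefOp_of_eigenbasis b h fun i => ?_
    obtain ⟨j, hj⟩ := exists_inner_le_eigenvalue_hsProj hop A b h i
    exact (hA.2 _ (b.orthonormal.ne_zero j)).trans_le hj

namespace IsPreconditionerSpace

variable {𝓗 : Submodule ℝ (E →ₗ[ℝ] E)} (h𝓗 : IsPreconditionerSpace 𝓗)
include h𝓗

theorem posSemidef_hsProj {A : E →ₗ[ℝ] E} (hA : IsPosSemidefOp A) :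
    IsPosSemidefOp (hsProj 𝓗 A) := by
  have hs := h𝓗.isSymmetric _ (hsProj_mem 𝓗 A)
  obtain ⟨b, l, h⟩ := hs.exists_eigenbasis
  refine ⟨hs, fun x => ?_⟩
  rw [inner_apply_eq_sum_of_eigenbasis b h]
  refine Finset.sum_nonneg fun i _ => mul_nonneg ?_ (mul_self_nonneg _)
  obtain ⟨j, hj⟩ := exists_inner_le_eigenvalue_hsProj h𝓗.opFun_mem A b h i
  exact (hA.2 _).trans hj

theorem one_mem : (1 : E →ₗ[ℝ] E) ∈ 𝓗 := by
  -- The zero operator has spectrum contained in `{0}`, and the constant function `1` turns it into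
  -- the identity.
  have h := h𝓗.opFun_mem (fun _ => 1) 0 𝓗.zero_mem
  convert h
  ext v
  rw [opFun_apply_of_eigenvector (A := 0) (fun _ _ => by simp) (fun _ => 1) (l := 0) (v := v)
    (by simp), one_smul]
  rfl

theorem inverse_mem {A : E →ₗ[ℝ] E} (hA : A ∈ 𝓗) (hp : IsPosDefOp A) : Ring.inverse A ∈ 𝓗 := by
  rw [hp.inverse_eq_opFun]
  exact h𝓗.opFun_mem _ A hA

theorem regularized_mem (δ : ℝ) (S : E →ₗ[ℝ] E) : δ • (1 : E →ₗ[ℝ] E) + hsProj 𝓗 S ∈ 𝓗 :=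
  𝓗.add_mem (𝓗.smul_mem δ h𝓗.one_mem) (hsProj_mem 𝓗 S)

theorem regularized_posDef {δ : ℝ} (hδ : 0 < δ) {S : E →ₗ[ℝ] E} (hS : IsPosSemidefOp S) :
    IsPosDefOp (δ • (1 : E →ₗ[ℝ] E) + hsProj 𝓗 S) :=
  (isPosDefOp_id.smul hδ).add_posSemidef (h𝓗.posSemidef_hsProj hS)

end IsPreconditionerSpace

theorem hsInner_id_opFun_potential {H : E →ₗ[ℝ] E} (hH : IsPosDefOp H) (δ η : ℝ) :
    hsInner LinearMap.id (opFun (potential δ η) H) =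
      δ * LinearMap.trace ℝ E H + η ^ 2 * LinearMap.trace ℝ E (Ring.inverse H) := by
  obtain ⟨b, l, h⟩ := hH.1.exists_eigenbasis
  rw [hsInner_id_left, hH.inverse_eq_opFun,
    trace_eq_sum_of_eigenbasis b (opFun_apply_eigenbasis b h _), trace_eq_sum_of_eigenbasis b h,
    trace_eq_sum_of_eigenbasis b (opFun_apply_eigenbasis b h _), Finset.mul_sum, Finset.mul_sum,
    ← Finset.sum_add_distrib]
  rfl

/-- For `H ∈ 𝓗` the objective is `⟨H, Q²⟩ + η² tr H⁻¹` with `Q² = δ I + proj_𝓗 S`: the linear part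
of the potential supplies `δ I`. The first term on the right does not depend on `H`. -/
theorem IsPreconditionerSpace.objective_eq {𝓗 : Submodule ℝ (E →ₗ[ℝ] E)}
    (h𝓗 : IsPreconditionerSpace 𝓗) {δ : ℝ} (hδ : 0 < δ) (η : ℝ) {S H : E →ₗ[ℝ] E}
    (hS : IsPosSemidefOp S) (hH : H ∈ 𝓗) (hp : IsPosDefOp H) :
    hsInner H S + hsInner LinearMap.id (opFun (potential δ η) H) =
      2 * η * LinearMap.trace ℝ E (sqrtOp (δ • 1 + hsProj 𝓗 S)) +
        hsInner (H * sqrtOp (δ • 1 + hsProj 𝓗 S) - η • 1)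
          (Ring.inverse H * (H * sqrtOp (δ • 1 + hsProj 𝓗 S) - η • 1)) := by
  have hA := h𝓗.regularized_posDef hδ hS
  rw [← trace_mul_sq_add hp hA.sqrt.1, hA.sqrtOp_mul_self, hsInner_id_opFun_potential hp,
    hsInner_add_right, hsInner_smul_right, hsInner_hsProj _ hH, hsInner_comm H 1]
  change _ = δ * hsInner LinearMap.id H + _ + _
  rw [hsInner_id_left]
  ring

/-- The residual square vanishes precisely when `H Q = η I`, and `η Q⁻¹` is feasible because `𝓗` is
closed under operator functions. This gives existence and uniqueness of the minimizer together. -/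
theorem IsPreconditionerSpace.isPreconditioner_iff {𝓗 : Submodule ℝ (E →ₗ[ℝ] E)}
    (h𝓗 : IsPreconditionerSpace 𝓗) {δ η : ℝ} (hδ : 0 < δ) (hη : 0 < η) {S H : E →ₗ[ℝ] E}
    (hS : IsPosSemidefOp S) :
    IsPreconditioner 𝓗 δ η S H ↔ H = η • invSqrtOp (δ • 1 + hsProj 𝓗 S) := by
  have hA := h𝓗.regularized_posDef hδ hS
  have hmem : η • invSqrtOp (δ • 1 + hsProj 𝓗 S) ∈ 𝓗 :=
    𝓗.smul_mem η (h𝓗.opFun_mem _ _ (h𝓗.regularized_mem δ S))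
  have hpos : IsPosDefOp (η • invSqrtOp (δ • 1 + hsProj 𝓗 S)) := hA.invSqrt.smul hη
  have hzero : η • invSqrtOp (δ • 1 + hsProj 𝓗 S) * sqrtOp (δ • 1 + hsProj 𝓗 S) - η • 1 = 0 := by
    rw [smul_mul_assoc, ← hA.inverse_sqrtOp, Ring.inverse_mul_cancel _ hA.sqrt.isUnit, sub_self]
  have hval := h𝓗.objective_eq hδ η hS hmem hpos
  rw [hzero, mul_zero] at hval
  have h00 : hsInner (0 : E →ₗ[ℝ] E) 0 = 0 := by simp [hsInner_eq_sum]
  rw [h00, add_zero] at hval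
  constructor
  · rintro ⟨⟨hH, hp⟩, hmin⟩
    have h1 := hmin _ hmem hpos
    rw [hval, h𝓗.objective_eq hδ η hS hH hp] at h1
    have h2 := eq_zero_of_hsInner_mul_self hp.inverse
      (le_antisymm (by linarith) (hsInner_mul_self_nonneg hp.inverse.posSemidef _))
    rw [sub_eq_zero] at h2
    rw [← hA.inverse_sqrtOp]
    calc H = H * sqrtOp (δ • 1 + hsProj 𝓗 S) * Ring.inverse (sqrtOp (δ • 1 + hsProj 𝓗 S)) := by
          rw [mul_assoc, Ring.mul_inverse_cancel _ hA.sqrt.isUnit, mul_one]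
      _ = _ := by rw [h2, smul_mul_assoc, one_mul]
  · rintro rfl
    refine ⟨⟨hmem, hpos⟩, fun H' hH' hp' => ?_⟩
    rw [hval, h𝓗.objective_eq hδ η hS hH' hp']
    linarith [hsInner_mul_self_nonneg hp'.inverse.posSemidef
      (H' * sqrtOp (δ • 1 + hsProj 𝓗 S) - η • 1)]

theorem isPrecondStep_iff {H : E →ₗ[ℝ] E} (hH : IsPosDefOp H) (g x x' : E) :
    IsPrecondStep H g x x' ↔ x' = x - H g := by
  -- The square is completed around the point `x - H g`.
  have key : ∀ y : E, inner ℝ g y + 1 / 2 * wNormSq (Ring.inverse H) (y - x) =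
      inner ℝ g x - 1 / 2 * inner ℝ g (H g) + 1 / 2 * wNormSq (Ring.inverse H) (y - x + H g) := by
    intro y
    have h1 : inner ℝ (H g) (Ring.inverse H (y - x)) = inner ℝ g (y - x) := by
      rw [← hH.inverse.1, hH.inverse_apply]
    rw [wNormSq, wNormSq, map_add, hH.inverse_apply, inner_add_left, inner_add_right,
      inner_add_right, h1, real_inner_comm g (y - x), real_inner_comm g (H g), inner_sub_right]
    ring
  constructor
  · intro h
    have h1 := h (x - H g)
    rw [key, key] at h1
    have h2 : x - H g - x + H g = 0 := by abel
    rw [h2] at h1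
    have h3 : wNormSq (Ring.inverse H) 0 = 0 := by simp [wNormSq]
    rw [h3] at h1
    have h4 : x' - x + H g = 0 := by
      by_contra h0
      have : 0 < wNormSq (Ring.inverse H) (x' - x + H g) := hH.inverse.2 _ h0
      linarith
    rw [← sub_eq_zero, ← h4]
    abel
  · rintro rfl y
    rw [key, key]
    have h2 : x - H g - x + H g = 0 := by abel
    rw [h2]
    have h3 : wNormSq (Ring.inverse H) 0 = 0 := by simp [wNormSq]
    rw [h3]
    have : 0 ≤ wNormSq (Ring.inverse H) (y - x + H g) := hH.inverse.posSemidef.2 _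
    linarith

theorem isPosSemidefOp_sum {ι : Type*} (s : Finset ι) {A : ι → E →ₗ[ℝ] E}
    (hA : ∀ i ∈ s, IsPosSemidefOp (A i)) : IsPosSemidefOp (∑ i ∈ s, A i) := by
  refine ⟨fun x y => ?_, fun x => ?_⟩
  · simp only [LinearMap.sum_apply, sum_inner, inner_sum]
    exact Finset.sum_congr rfl fun i hi => (hA i hi).1 x y
  · simp only [LinearMap.sum_apply, inner_sum]
    exact Finset.sum_nonneg fun i hi => (hA i hi).2 x

/-- The regularized, projected second moments of the gradients. -/
noncomputable def gramOp (𝓗 : Submodule ℝ (E →ₗ[ℝ] E)) (δ : ℝ) (g : ℕ → E) (n : ℕ) : E →ₗ[ℝ] E :=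
  δ • 1 + hsProj 𝓗 (∑ i ∈ Finset.range n, rankOneOp (g i) (g i))

theorem IsPreconditionerSpace.gramOp_posDef {𝓗 : Submodule ℝ (E →ₗ[ℝ] E)}
    (h𝓗 : IsPreconditionerSpace 𝓗) {δ : ℝ} (hδ : 0 < δ) (g : ℕ → E) (n : ℕ) :
    IsPosDefOp (gramOp 𝓗 δ g n) :=
  h𝓗.regularized_posDef hδ (isPosSemidefOp_sum _ fun i _ => isPosSemidefOp_rankOneOp (g i))

theorem gramOp_eq (𝓗 : Submodule ℝ (E →ₗ[ℝ] E)) (δ : ℝ) (g : ℕ → E) (n : ℕ) :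
    gramOp 𝓗 δ g n = δ • 1 + ∑ i ∈ Finset.range n, hsProj 𝓗 (rankOneOp (g i) (g i)) := by
  rw [gramOp, hsProj_sum]

/-- `gramOp` at `n` contains the gradients with index below `n`; step `k` already uses its own
gradient `g k`, hence the index `k + 1`. -/
theorem IsPreconditionerSpace.isAdaptiveRun_iff {𝓗 : Submodule ℝ (E →ₗ[ℝ] E)}
    (h𝓗 : IsPreconditionerSpace 𝓗) {δ η : ℝ} (hδ : 0 < δ) (hη : 0 < η) (K : ℕ) (x g : ℕ → E) :
    IsAdaptiveRun 𝓗 δ η K x g ↔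
      ∀ k ≤ K, x (k + 1) = x k - η • invSqrtOp (gramOp 𝓗 δ g (k + 1)) (g k) := by
  refine forall₂_congr fun k _ => ?_
  have hS : IsPosSemidefOp (∑ i ∈ Finset.range (k + 1), rankOneOp (g i) (g i)) :=
    isPosSemidefOp_sum _ fun i _ => isPosSemidefOp_rankOneOp (g i)
  have hp : IsPosDefOp (η • invSqrtOp (gramOp 𝓗 δ g (k + 1))) :=
    (h𝓗.gramOp_posDef hδ g (k + 1)).invSqrt.smul hη
  constructor
  · rintro ⟨H, h1, h2⟩
    rw [h𝓗.isPreconditioner_iff hδ hη hS] at h1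
    subst h1
    exact (isPrecondStep_iff hp _ _ _).1 h2
  · intro h
    exact ⟨_, (h𝓗.isPreconditioner_iff hδ hη hS).2 rfl, (isPrecondStep_iff hp _ _ _).2 h⟩

end Operators

/-! ### The four examples: admissibility and explicit updates. -/

section Examples

/-! ### Operator functions as polynomials -/

theorem exists_polynomial_eval_eq {s : Set ℝ} (hs : s.Finite) (ψ : ℝ → ℝ) :
    ∃ p : Polynomial ℝ, ∀ t ∈ s, p.eval t = ψ t := by
  classical
  refine ⟨Lagrange.interpolate hs.toFinset id ψ, fun t ht => ?_⟩
  exact Lagrange.eval_interpolate_at_node ψ (Function.injective_id.injOn) (hs.mem_toFinset.2 ht)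

/-- Only the values of `ψ` on the spectrum matter, so a polynomial can replace it; polynomials pass
through algebra homomorphisms. -/
theorem opFun_eq_aeval {E : Type*} [NormedAddCommGroup E] [InnerProductSpace ℝ E]
    [FiniteDimensional ℝ E] {A : E →ₗ[ℝ] E} (hA : A.IsSymmetric) {ψ : ℝ → ℝ} {p : Polynomial ℝ}
    (h : ∀ l, Module.End.HasEigenvalue A l → p.eval l = ψ l) :
    opFun ψ A = Polynomial.aeval (R := ℝ) (A := Module.End ℝ E) A p := by
  obtain ⟨b, l, hb⟩ := hA.exists_eigenbasis
  refine linearMap_ext_orthonormalBasis b fun i => ?_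
  have hv : Module.End.HasEigenvector A (l i) (b i) :=
    ⟨Module.End.mem_eigenspace_iff.2 (hb i), b.orthonormal.ne_zero i⟩
  rw [opFun_apply_eigenbasis b hb, Module.End.aeval_apply_of_hasEigenvector hv,
    h _ (Module.End.hasEigenvalue_of_hasEigenvector hv)]

/-! ### Diagonal preconditioners that are constant on blocks of coordinates -/

/-- The diagonal operator with diagonal `b`. -/
noncomputable def diagOp {ι : Type*} [Fintype ι] (b : ι → ℝ) :
    EuclideanSpace ℝ ι →ₗ[ℝ] EuclideanSpace ℝ ι where
  toFun x := WithLp.toLp 2 fun i => b i * x i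
  map_add' x y := by
    ext i
    simp [mul_add]
  map_smul' c x := by
    ext i
    simp [mul_left_comm]

section BlockDiagonal

variable {ι κ : Type*} [Fintype ι] [Fintype κ]

theorem diagOp_apply (b : ι → ℝ) (x : EuclideanSpace ℝ ι) (i : ι) :
    diagOp b x i = b i * x i := rfl

theorem diagOp_basisFun (b : ι → ℝ) (i : ι) :
    diagOp b (EuclideanSpace.basisFun ι ℝ i) = b i • EuclideanSpace.basisFun ι ℝ i := by
  classical
  ext j
  by_cases h : j = i
  · subst h; simp [diagOp_apply]
  · simp [diagOp_apply, h]

theorem opFun_diagOp (ψ : ℝ → ℝ) (b : ι → ℝ) : opFun ψ (diagOp b) = diagOp fun i => ψ (b i) :=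
  linearMap_ext_orthonormalBasis (EuclideanSpace.basisFun ι ℝ) fun i => by
    rw [opFun_apply_eigenbasis _ (diagOp_basisFun b), diagOp_basisFun]

theorem hsInner_diagOp (b c : ι → ℝ) : hsInner (diagOp b) (diagOp c) = ∑ i, b i * c i := by
  rw [hsInner_eq_sum_basis (EuclideanSpace.basisFun ι ℝ)]
  refine Finset.sum_congr rfl fun i _ => ?_
  rw [diagOp_basisFun, diagOp_basisFun, real_inner_smul_left, real_inner_smul_right,
    real_inner_self_eq_norm_sq, (EuclideanSpace.basisFun ι ℝ).orthonormal.1 i]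
  ring

theorem inner_diagOp (b : ι → ℝ) (x : EuclideanSpace ℝ ι) :
    inner ℝ x (diagOp b x) = ∑ i, b i * x i ^ 2 := by
  rw [PiLp.inner_apply]
  refine Finset.sum_congr rfl fun i _ => ?_
  simp [diagOp_apply]
  ring

variable {π : ι → κ} {𝓗 : Submodule ℝ (EuclideanSpace ℝ ι →ₗ[ℝ] EuclideanSpace ℝ ι)}

/-- One argument for three examples: `π` sends a coordinate to its block. A constant `π` gives
AdaGrad-Norm, the identity gives AdaGrad, and the row index gives DASGO. -/
theorem isPreconditionerSpace_of_mem_iff_diagOp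
    (h : ∀ T, T ∈ 𝓗 ↔ ∃ b : κ → ℝ, T = diagOp fun i => b (π i)) : IsPreconditionerSpace 𝓗 := by
  refine isPreconditionerSpace_of_opFun_mem (fun A hA => ?_) fun ψ A hA => ?_
  · obtain ⟨b, rfl⟩ := (h A).1 hA
    exact isSymmetric_of_eigenbasis _ (diagOp_basisFun _)
  · obtain ⟨b, rfl⟩ := (h A).1 hA
    rw [opFun_diagOp, h]
    exact ⟨fun k => ψ (b k), rfl⟩

/-- Projecting keeps the diagonal `x_j²` and averages it over each block; `N` is the common block
size, the source of `1/d` and `1/n` in the updates. -/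
theorem hsProj_rankOneOp_of_mem_iff_diagOp [DecidableEq κ]
    (h : ∀ T, T ∈ 𝓗 ↔ ∃ b : κ → ℝ, T = diagOp fun i => b (π i)) {N : ℕ}
    (hN : ∀ k, (Finset.univ.filter fun i => π i = k).card = N) (x : EuclideanSpace ℝ ι) :
    hsProj 𝓗 (rankOneOp x x) =
      diagOp fun i => 1 / (N : ℝ) * ∑ j with π j = π i, x j ^ 2 := by
  refine hsProj_eq_of_mem
    ((h _).2 ⟨fun k => 1 / (N : ℝ) * ∑ j with π j = k, x j ^ 2, rfl⟩) fun B hB => ?_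
  obtain ⟨b, rfl⟩ := (h B).1 hB
  rw [hsInner_comm, hsInner_rankOneOp, inner_diagOp, hsInner_diagOp,
    ← Finset.sum_fiberwise Finset.univ π, ← Finset.sum_fiberwise Finset.univ π]
  refine Finset.sum_congr rfl fun k _ => ?_
  have e1 : ∑ i with π i = k, b (π i) * x i ^ 2 = b k * ∑ i with π i = k, x i ^ 2 := by
    rw [Finset.mul_sum]
    refine Finset.sum_congr rfl fun i hi => ?_
    rw [(Finset.mem_filter.1 hi).2]
  have e2 : ∑ i with π i = k, (1 / (N : ℝ) * ∑ j with π j = π i, x j ^ 2) * b (π i) =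
      ∑ i with π i = k, (1 / (N : ℝ) * ∑ j with π j = k, x j ^ 2) * b k := by
    refine Finset.sum_congr rfl fun i hi => ?_
    rw [(Finset.mem_filter.1 hi).2]
  rw [e1, e2, Finset.sum_const, hN, nsmul_eq_mul]
  -- For `N = 0` every block is empty, so the convention `1 / 0 = 0` is harmless.
  rcases Nat.eq_zero_or_pos N with rfl | hpos
  · rw [Finset.card_eq_zero.1 (hN k)]
    simp
  · field_simp

theorem isAdaptiveRun_iff_of_mem_iff_diagOp [DecidableEq κ]
    (h : ∀ T, T ∈ 𝓗 ↔ ∃ b : κ → ℝ, T = diagOp fun i => b (π i)) {N : ℕ}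
    (hN : ∀ k, (Finset.univ.filter fun i => π i = k).card = N) {δ η : ℝ} (hδ : 0 < δ) (hη : 0 < η)
    (K : ℕ) (x g : ℕ → EuclideanSpace ℝ ι) :
    IsAdaptiveRun 𝓗 δ η K x g ↔ ∀ k ≤ K, ∀ i, x (k + 1) i =
      x k i - η / √(δ + 1 / (N : ℝ) *
        ∑ t ∈ Finset.range (k + 1), ∑ j with π j = π i, g t j ^ 2) * g k i := by
  rw [(isPreconditionerSpace_of_mem_iff_diagOp h).isAdaptiveRun_iff hδ hη]
  refine forall₂_congr fun k _ => ?_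
  have hg : gramOp 𝓗 δ g (k + 1) = diagOp fun i => δ + 1 / (N : ℝ) *
      ∑ t ∈ Finset.range (k + 1), ∑ j with π j = π i, g t j ^ 2 := by
    rw [gramOp_eq]
    ext v i
    simp only [hsProj_rankOneOp_of_mem_iff_diagOp h hN, LinearMap.add_apply, LinearMap.smul_apply,
      LinearMap.sum_apply, PiLp.add_apply, PiLp.smul_apply, WithLp.ofLp_sum, Finset.sum_apply,
      diagOp_apply, Module.End.one_apply, smul_eq_mul, Finset.mul_sum, Finset.sum_mul, add_mul]
  rw [hg, invSqrtOp, opFun_diagOp, PiLp.ext_iff]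
  refine forall_congr' fun i => ?_
  rw [PiLp.sub_apply, PiLp.smul_apply, diagOp_apply, smul_eq_mul, div_eq_mul_inv η, mul_assoc η]

end BlockDiagonal

theorem mem_adaGradNormSpace_iff {d : ℕ}
    (T : EuclideanSpace ℝ (Fin d) →ₗ[ℝ] EuclideanSpace ℝ (Fin d)) :
    T ∈ adaGradNormSpace d ↔ ∃ b : Unit → ℝ, T = diagOp fun _ => b () := by
  constructor
  · rintro ⟨β, h⟩
    refine ⟨fun _ => β, LinearMap.ext fun x => ?_⟩
    ext i
    simp [h, diagOp_apply]
  · rintro ⟨b, rfl⟩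
    refine ⟨b (), fun x => ?_⟩
    ext i
    simp [diagOp_apply]

theorem mem_adaGradSpace_iff {d : ℕ}
    (T : EuclideanSpace ℝ (Fin d) →ₗ[ℝ] EuclideanSpace ℝ (Fin d)) :
    T ∈ adaGradSpace d ↔ ∃ b : Fin d → ℝ, T = diagOp fun i => b i := by
  constructor
  · rintro ⟨b, h⟩
    refine ⟨b, LinearMap.ext fun x => ?_⟩
    ext i
    simp [h, diagOp_apply]
  · rintro ⟨b, rfl⟩
    exact ⟨b, fun x i => rfl⟩

theorem MatSpace.mat_injective {m n : ℕ} :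
    Function.Injective (MatSpace.mat : MatSpace m n → Matrix (Fin m) (Fin n) ℝ) := fun x y h => by
  ext ⟨i, j⟩
  exact congrFun (congrFun h i) j

theorem mem_dasgoSpace_iff {m n : ℕ} (T : MatSpace m n →ₗ[ℝ] MatSpace m n) :
    T ∈ dasgoSpace m n ↔ ∃ b : Fin m → ℝ, T = diagOp fun i => b i.1 := by
  constructor
  · rintro ⟨b, h⟩
    refine ⟨b, LinearMap.ext fun x => MatSpace.mat_injective ?_⟩
    rw [h]
    ext i j
    simp [MatSpace.mat, diagOp_apply]
  · rintro ⟨b, rfl⟩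
    refine ⟨b, fun x => ?_⟩
    ext i j
    simp [MatSpace.mat, diagOp_apply]

theorem isAdaptiveRun_adaGradNormSpace_iff {d : ℕ} {δ η : ℝ} (hδ : 0 < δ) (hη : 0 < η) (K : ℕ)
    (x g : ℕ → EuclideanSpace ℝ (Fin d)) :
    IsAdaptiveRun (adaGradNormSpace d) δ η K x g ↔ IsAdaGradNormRun δ η K x g := by
  rw [isAdaptiveRun_iff_of_mem_iff_diagOp (π := fun _ : Fin d => ())
    mem_adaGradNormSpace_iff (N := d) (by simp) hδ hη]
  refine forall₂_congr fun k _ => ?_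
  rw [PiLp.ext_iff]
  refine forall_congr' fun i => ?_
  simp [EuclideanSpace.norm_sq_eq]

theorem isAdaptiveRun_adaGradSpace_iff {d : ℕ} {δ η : ℝ} (hδ : 0 < δ) (hη : 0 < η) (K : ℕ)
    (x g : ℕ → EuclideanSpace ℝ (Fin d)) :
    IsAdaptiveRun (adaGradSpace d) δ η K x g ↔ IsAdaGradRun δ η K x g := by
  have hN : ∀ j : Fin d, (Finset.univ.filter fun i : Fin d => i = j).card = 1 := fun j => by
    rw [Finset.filter_eq']
    simp
  rw [isAdaptiveRun_iff_of_mem_iff_diagOp (π := fun i : Fin d => i)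
    mem_adaGradSpace_iff hN hδ hη]
  refine forall₂_congr fun k _ => forall_congr' fun i => ?_
  simp [Finset.filter_eq']

theorem sum_filter_fst_eq {m n : ℕ} (p : Fin m) (f : Fin m × Fin n → ℝ) :
    ∑ j with j.1 = p, f j = ∑ s, f (p, s) := by
  rw [Finset.sum_filter, Fintype.sum_prod_type, Finset.sum_eq_single p]
  · simp
  · intro q _ hq
    simp [hq]
  · simp

theorem isAdaptiveRun_dasgoSpace_iff {m n : ℕ} {δ η : ℝ} (hδ : 0 < δ) (hη : 0 < η) (K : ℕ)
    (x g : ℕ → MatSpace m n) :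
    IsAdaptiveRun (dasgoSpace m n) δ η K x g ↔ IsDASGORun δ η K x g := by
  have hN : ∀ p : Fin m, (Finset.univ.filter fun i : Fin m × Fin n => i.1 = p).card = n := by
    intro p
    have h := sum_filter_fst_eq (n := n) p fun _ => 1
    simp only [Finset.sum_const, nsmul_eq_mul, mul_one, Finset.card_univ, Fintype.card_fin] at h
    exact_mod_cast h
  rw [isAdaptiveRun_iff_of_mem_iff_diagOp (π := fun i : Fin m × Fin n => i.1)
    mem_dasgoSpace_iff hN hδ hη]
  refine forall₂_congr fun k _ => ?_
  simp only [sum_filter_fst_eq, Prod.forall]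
  rfl

/-! ### Left multiplication by symmetric matrices -/

/-- Left multiplication by a matrix as an operator on the space of matrices. -/
noncomputable def leftMulOp (m n : ℕ) :
    Matrix (Fin m) (Fin m) ℝ →ₐ[ℝ] Module.End ℝ (MatSpace m n) :=
  AlgHom.ofLinearMap
    { toFun := fun C =>
        { toFun := fun x => WithLp.toLp 2 fun p => (C * x.mat) p.1 p.2
          map_add' := fun x y => MatSpace.mat_injective (Matrix.mul_add C x.mat y.mat)
          map_smul' := fun c x => MatSpace.mat_injective (Matrix.mul_smul C c x.mat) }
      map_add' := fun A B => LinearMap.ext fun x =>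
        MatSpace.mat_injective (Matrix.add_mul A B x.mat)
      map_smul' := fun c A => LinearMap.ext fun x =>
        MatSpace.mat_injective (Matrix.smul_mul c A x.mat) }
    (LinearMap.ext fun x => MatSpace.mat_injective (Matrix.one_mul x.mat))
    (fun A B => LinearMap.ext fun x => MatSpace.mat_injective (Matrix.mul_assoc A B x.mat))

theorem mat_leftMulOp {m n : ℕ} (C : Matrix (Fin m) (Fin m) ℝ) (x : MatSpace m n) :
    (leftMulOp m n C x).mat = C * x.mat := rfl

theorem mem_asgoSpace_iff {m n : ℕ} (T : MatSpace m n →ₗ[ℝ] MatSpace m n) :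
    T ∈ asgoSpace m n ↔ ∃ B : Matrix (Fin m) (Fin m) ℝ, B.IsSymm ∧ T = leftMulOp m n B := by
  refine exists_congr fun B => and_congr_right fun _ => ⟨fun h => ?_, ?_⟩
  · exact LinearMap.ext fun x => MatSpace.mat_injective (h x)
  · rintro rfl x
    rfl

theorem MatSpace.inner_eq_trace {m n : ℕ} (x y : MatSpace m n) :
    inner ℝ x y = (x.mat.transpose * y.mat).trace := by
  rw [PiLp.inner_apply, Fintype.sum_prod_type, Finset.sum_comm, Matrix.trace]
  refine Finset.sum_congr rfl fun j _ => ?_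
  rw [Matrix.diag_apply, Matrix.mul_apply]
  refine Finset.sum_congr rfl fun i _ => ?_
  simp [MatSpace.mat, mul_comm]

theorem leftMulOp_isSymmetric {m n : ℕ} {B : Matrix (Fin m) (Fin m) ℝ} (hB : B.IsSymm) :
    (leftMulOp m n B).IsSymmetric := fun x y => by
  rw [MatSpace.inner_eq_trace, MatSpace.inner_eq_trace, mat_leftMulOp, mat_leftMulOp,
    Matrix.transpose_mul, hB.eq, Matrix.mul_assoc]

/-- Left multiplication acts on each of the `n` columns separately and identically, which produces
the factor `n` and later the `1/n` of ASGO. -/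
theorem hsInner_leftMulOp {m n : ℕ} (A B : Matrix (Fin m) (Fin m) ℝ) :
    hsInner (leftMulOp m n A) (leftMulOp m n B) = n * (A.transpose * B).trace := by
  rw [hsInner_eq_sum_basis (EuclideanSpace.basisFun (Fin m × Fin n) ℝ)]
  have key : ∀ (i : Fin m) (j : Fin n) (C : Matrix (Fin m) (Fin m) ℝ) (k : Fin m) (l : Fin n),
      leftMulOp m n C (EuclideanSpace.basisFun (Fin m × Fin n) ℝ (i, j)) (k, l) =
        if l = j then C k i else 0 := by
    intro i j C k l
    change (C * MatSpace.mat (EuclideanSpace.basisFun (Fin m × Fin n) ℝ (i, j))) k l = _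
    rw [Matrix.mul_apply, Finset.sum_eq_single i]
    · by_cases h : l = j <;> simp [MatSpace.mat, h]
    · intro q _ hq
      simp [MatSpace.mat, hq]
    · simp
  rw [Fintype.sum_prod_type, Matrix.trace, Finset.mul_sum]
  refine Finset.sum_congr rfl fun i _ => ?_
  have : ∀ j : Fin n, inner ℝ
      (leftMulOp m n A (EuclideanSpace.basisFun (Fin m × Fin n) ℝ (i, j)))
      (leftMulOp m n B (EuclideanSpace.basisFun (Fin m × Fin n) ℝ (i, j))) =
        (A.transpose * B).diag i := by
    intro j
    rw [PiLp.inner_apply, Fintype.sum_prod_type, Matrix.diag_apply, Matrix.mul_apply]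
    refine Finset.sum_congr rfl fun k _ => ?_
    simp only [key]
    simp [mul_comm]
  simp only [this, Finset.sum_const, Finset.card_univ, Fintype.card_fin, nsmul_eq_mul]

/-- One polynomial interpolates `ψ` on the union of the eigenvalues of the operator and the spectrum
of the matrix, so the two spectra need not be compared; `leftMulOp` commutes with it as an algebra
homomorphism. -/
theorem opFun_leftMulOp {m n : ℕ} {B : Matrix (Fin m) (Fin m) ℝ} (hB : B.IsSymm) (ψ : ℝ → ℝ) :
    opFun ψ (leftMulOp m n B) = leftMulOp m n (cfc ψ B) := by
  have hsa : IsSelfAdjoint B := by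
    rw [IsSelfAdjoint, Matrix.star_eq_conjTranspose, Matrix.conjTranspose_eq_transpose_of_trivial]
    exact hB
  have hfin : ({l | Module.End.HasEigenvalue (leftMulOp m n B) l} ∪ spectrum ℝ B).Finite :=
    (Module.End.finite_hasEigenvalue _).union (Matrix.finite_real_spectrum)
  obtain ⟨p, hp⟩ := exists_polynomial_eval_eq hfin ψ
  rw [opFun_eq_aeval (leftMulOp_isSymmetric hB) (p := p) fun l hl => hp l (Or.inl hl),
    Polynomial.aeval_algHom_apply,
    ← cfc_congr (f := p.eval) (fun t ht => hp t (Or.inr ht)), cfc_polynomial p B hsa]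

theorem isSymm_cfc {m : ℕ} (B : Matrix (Fin m) (Fin m) ℝ) (ψ : ℝ → ℝ) : (cfc ψ B).IsSymm := by
  have h : IsSelfAdjoint (cfc ψ B) := cfc_predicate ψ B
  rwa [IsSelfAdjoint, Matrix.star_eq_conjTranspose,
    Matrix.conjTranspose_eq_transpose_of_trivial] at h

theorem isPreconditionerSpace_asgoSpace (m n : ℕ) : IsPreconditionerSpace (asgoSpace m n) := by
  refine isPreconditionerSpace_of_opFun_mem (fun A hA => ?_) fun ψ A hA => ?_
  · obtain ⟨B, hB, rfl⟩ := (mem_asgoSpace_iff A).1 hA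
    exact leftMulOp_isSymmetric hB
  · obtain ⟨B, hB, rfl⟩ := (mem_asgoSpace_iff A).1 hA
    rw [opFun_leftMulOp hB, mem_asgoSpace_iff]
    exact ⟨_, isSymm_cfc B ψ, rfl⟩

theorem hsProj_asgoSpace_rankOneOp {m n : ℕ} (x : MatSpace m n) :
    hsProj (asgoSpace m n) (rankOneOp x x) =
      leftMulOp m n ((1 / (n : ℝ)) • (x.mat * x.mat.transpose)) := by
  have hsymm : ((1 / (n : ℝ)) • (x.mat * x.mat.transpose)).IsSymm :=
    Matrix.IsSymm.smul (by rw [Matrix.IsSymm, Matrix.transpose_mul, Matrix.transpose_transpose]) _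
  refine hsProj_eq_of_mem ((mem_asgoSpace_iff _).2 ⟨_, hsymm, rfl⟩) fun B hB => ?_
  obtain ⟨B, hB, rfl⟩ := (mem_asgoSpace_iff B).1 hB
  rw [hsInner_comm, hsInner_rankOneOp, hsInner_leftMulOp, hsymm.eq, MatSpace.inner_eq_trace,
    mat_leftMulOp, Matrix.smul_mul, Matrix.trace_smul, ← Matrix.mul_assoc, Matrix.trace_mul_comm,
    ← Matrix.mul_assoc, smul_eq_mul]
  rcases Nat.eq_zero_or_pos n with rfl | hn
  · simp [Matrix.trace]
  · field_simp

theorem isAdaptiveRun_asgoSpace_iff {m n : ℕ} {δ η : ℝ} (hδ : 0 < δ) (hη : 0 < η) (K : ℕ)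
    (x g : ℕ → MatSpace m n) :
    IsAdaptiveRun (asgoSpace m n) δ η K x g ↔ IsASGORun δ η K x g := by
  rw [(isPreconditionerSpace_asgoSpace m n).isAdaptiveRun_iff hδ hη]
  refine forall₂_congr fun k _ => ?_
  have hsymm : (δ • (1 : Matrix (Fin m) (Fin m) ℝ) + (1 / (n : ℝ)) •
      ∑ i ∈ Finset.range (k + 1), (g i).mat * (g i).mat.transpose).IsSymm := by
    refine (Matrix.isSymm_one.smul δ).add (Matrix.IsSymm.smul ?_ _)
    rw [Matrix.IsSymm, Matrix.transpose_sum]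
    exact Finset.sum_congr rfl fun i _ => by
      rw [Matrix.transpose_mul, Matrix.transpose_transpose]
  have hg : gramOp (asgoSpace m n) δ g (k + 1) = leftMulOp m n (δ • 1 + (1 / (n : ℝ)) •
      ∑ i ∈ Finset.range (k + 1), (g i).mat * (g i).mat.transpose) := by
    rw [gramOp_eq, map_add, map_smul, map_one, Finset.smul_sum, map_sum]
    simp only [hsProj_asgoSpace_rankOneOp]
  rw [hg, invSqrtOp, opFun_leftMulOp hsymm, ← MatSpace.mat_injective.eq_iff]
  rfl

end Examples

/-! ### The pathwise regret bound. -/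

section Regret

variable {E : Type*} [NormedAddCommGroup E] [InnerProductSpace ℝ E] [FiniteDimensional ℝ E]

/-! ### Inequalities for quadratic forms -/

theorem trace_one_eq_finrank : LinearMap.trace ℝ E (1 : E →ₗ[ℝ] E) = Module.finrank ℝ E :=
  LinearMap.trace_one ℝ E

theorem IsPosDefOp.inverse_inverse {A : E →ₗ[ℝ] E} (hA : IsPosDefOp A) :
    Ring.inverse (Ring.inverse A) = A := by
  refine LinearMap.ext fun x => ?_
  conv_lhs => rw [← hA.inverse_apply x]
  rw [hA.inverse.inverse_apply]

/-- For `A ∈ 𝓗` the form is `⟨A, proj_𝓗 (y⟨y, ·⟩)⟩`, and trace–operator norm duality applies. This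
is why `𝓡` is the right size of the iterates. -/
theorem inner_le_trace_mul_precNorm_sq {𝓗 : Submodule ℝ (E →ₗ[ℝ] E)} {A : E →ₗ[ℝ] E}
    (hA : A ∈ 𝓗) (hp : IsPosSemidefOp A) (y : E) :
    inner ℝ y (A y) ≤ LinearMap.trace ℝ E A * precNorm 𝓗 y ^ 2 := by
  obtain ⟨b, l, h, hl⟩ := hp.exists_eigenbasis
  have hsq : precNorm 𝓗 y ^ 2 = opNorm (hsProj 𝓗 (rankOneOp y y)) :=
    Real.sq_sqrt (norm_nonneg _)
  rw [← hsInner_rankOneOp, ← hsInner_hsProj _ hA, hsq, hsInner_eq_sum_basis b,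
    trace_eq_sum_of_eigenbasis b h, Finset.sum_mul]
  refine Finset.sum_le_sum fun i _ => ?_
  rw [h, real_inner_smul_left]
  refine mul_le_mul_of_nonneg_left ?_ (hl i)
  refine (real_inner_le_norm _ _).trans ?_
  have := (LinearMap.toContinuousLinearMap (hsProj 𝓗 (rankOneOp y y))).le_opNorm (b i)
  rw [b.orthonormal.1 i] at this ⊢
  simpa [opNorm] using this

theorem IsPreconditionerSpace.norm_sq_le {𝓗 : Submodule ℝ (E →ₗ[ℝ] E)}
    (h𝓗 : IsPreconditionerSpace 𝓗) (y : E) :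
    ‖y‖ ^ 2 ≤ Module.finrank ℝ E * precNorm 𝓗 y ^ 2 := by
  have h := inner_le_trace_mul_precNorm_sq h𝓗.one_mem isPosDefOp_id.posSemidef y
  rwa [trace_one_eq_finrank, Module.End.one_apply, real_inner_self_eq_norm_sq] at h

/-- Weighted Young inequality, from the nonnegativity of the squared `C⁻¹`-norm of `u - a C h`. -/
theorem two_mul_inner_le_wNormSq {C : E →ₗ[ℝ] E} (hC : IsPosDefOp C) {a : ℝ} (ha : 0 < a)
    (u h : E) : 2 * inner ℝ u h ≤ wNormSq (Ring.inverse C) u / a + a * inner ℝ h (C h) := by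
  have h0 := hC.inverse.posSemidef.2 (u - a • C h)
  have h1 : inner ℝ (C h) (Ring.inverse C u) = inner ℝ h u := by rw [hC.1, hC.apply_inverse]
  have h2 : inner ℝ (C h) h = inner ℝ h (C h) := real_inner_comm _ _
  simp only [map_sub, map_smul, hC.inverse_apply, inner_sub_left, inner_sub_right,
    real_inner_smul_left, real_inner_smul_right, h1, h2] at h0
  rw [real_inner_comm u h] at h0
  rw [wNormSq, ← sub_nonneg]
  have : inner ℝ u (Ring.inverse C u) / a + a * inner ℝ h (C h) - 2 * inner ℝ u h =
    (inner ℝ u (Ring.inverse C u) - a * inner ℝ u h - a * (inner ℝ u h - a * inner ℝ h (C h))) /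
      a := by
    field_simp
    ring
  rw [this]
  exact div_nonneg (by linarith) ha.le

/-- The dual norm of a sum of quadratic forms is dominated by the infimal convolution of the dual
norms. -/
theorem wNormSq_inverse_add_le {B L M : E →ₗ[ℝ] E} (hB : IsPosDefOp B) (hL : IsPosDefOp L)
    (hM : IsPosDefOp M) {a c : ℝ} (ha : 0 < a) (hc : 0 < c)
    (hle : ∀ h, a * inner ℝ h (L h) + c * inner ℝ h (M h) ≤ inner ℝ h (B h)) (u v : E) :
    wNormSq (Ring.inverse B) (u + v) ≤
      wNormSq (Ring.inverse L) u / a + wNormSq (Ring.inverse M) v / c := by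
  -- This `h` is the maximizer in `‖z‖²_{B⁻¹} = sup_h (2⟨z, h⟩ - ⟨h, B h⟩)` with `z = u + v`; Young
  -- is applied to `u` and `v` separately at this point.
  set h := Ring.inverse B (u + v) with hh
  have h1 := two_mul_inner_le_wNormSq hL ha u h
  have h2 := two_mul_inner_le_wNormSq hM hc v h
  have h3 := hle h
  have h4 : B h = u + v := hB.apply_inverse _
  have h5 : wNormSq (Ring.inverse B) (u + v) = inner ℝ u h + inner ℝ v h := by
    rw [wNormSq, ← hh, inner_add_left]
  rw [h4, inner_add_right, real_inner_comm u h, real_inner_comm v h] at h3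
  linarith

theorem wNormSq_inverse_le_norm_sq {B : E →ₗ[ℝ] E} (hB : IsPosDefOp B) {s : ℝ} (hs : 0 < s)
    (hle : ∀ h, s * ‖h‖ ^ 2 ≤ inner ℝ h (B h)) (u : E) :
    wNormSq (Ring.inverse B) u ≤ ‖u‖ ^ 2 / s := by
  -- The single-operator case is recovered by cutting both `s` and `u` into equal halves.
  have h1 := wNormSq_inverse_add_le hB isPosDefOp_id isPosDefOp_id (half_pos hs) (half_pos hs)
    (fun h => by
      have := hle h
      simp only [LinearMap.id_apply, real_inner_self_eq_norm_sq]
      linarith) ((1 / 2 : ℝ) • u) ((1 / 2 : ℝ) • u)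
  have h2 : (1 / 2 : ℝ) • u + (1 / 2 : ℝ) • u = u := by rw [← add_smul]; norm_num
  have h3 : Ring.inverse (LinearMap.id : E →ₗ[ℝ] E) = LinearMap.id := Ring.inverse_one _
  have h4 : wNormSq LinearMap.id ((1 / 2 : ℝ) • u) = ‖u‖ ^ 2 / 4 := by
    rw [wNormSq, LinearMap.id_apply, real_inner_smul_left, real_inner_smul_right,
      real_inner_self_eq_norm_sq]
    ring
  rw [h2, h3, h4] at h1
  refine h1.trans (le_of_eq ?_)
  field_simp
  ring

theorem mul_trace_inverse_le {B : E →ₗ[ℝ] E} (hB : IsPosDefOp B) {s : ℝ} (hs : 0 < s)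
    (hle : ∀ h, s * ‖h‖ ^ 2 ≤ inner ℝ h (B h)) :
    s * LinearMap.trace ℝ E (Ring.inverse B) ≤ Module.finrank ℝ E := by
  rw [LinearMap.trace_eq_sum_inner _ (stdOrthonormalBasis ℝ E), Finset.mul_sum]
  calc _ ≤ ∑ _i : Fin (Module.finrank ℝ E), (1 : ℝ) := by
        refine Finset.sum_le_sum fun i _ => ?_
        have h := wNormSq_inverse_le_norm_sq hB hs hle (stdOrthonormalBasis ℝ E i)
        rw [(stdOrthonormalBasis ℝ E).orthonormal.1 i, le_div_iff₀ hs] at h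
        rw [wNormSq] at h
        linarith
    _ = _ := by simp

/-! ### The regret of adaptive preconditioning -/

section

variable {𝓗 : Submodule ℝ (E →ₗ[ℝ] E)} (h𝓗 : IsPreconditionerSpace 𝓗) {δ : ℝ} (hδ : 0 < δ)
  (g : ℕ → E)

theorem gramOp_succ (𝓗 : Submodule ℝ (E →ₗ[ℝ] E)) (δ : ℝ) (g : ℕ → E) (n : ℕ) :
    gramOp 𝓗 δ g (n + 1) = gramOp 𝓗 δ g n + hsProj 𝓗 (rankOneOp (g n) (g n)) := by
  rw [gramOp_eq, gramOp_eq, Finset.sum_range_succ, add_assoc]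

include h𝓗

theorem sqrtOp_gramOp_mem (n : ℕ) : sqrtOp (gramOp 𝓗 δ g n) ∈ 𝓗 :=
  h𝓗.opFun_mem _ _ (h𝓗.regularized_mem δ _)

theorem invSqrtOp_gramOp_mem (n : ℕ) : invSqrtOp (gramOp 𝓗 δ g n) ∈ 𝓗 :=
  h𝓗.opFun_mem _ _ (h𝓗.regularized_mem δ _)

include hδ

theorem sub_sqrtOp_gramOp_posSemidef (n : ℕ) :
    IsPosSemidefOp (sqrtOp (gramOp 𝓗 δ g (n + 1)) - sqrtOp (gramOp 𝓗 δ g n)) := by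
  have h1 := h𝓗.gramOp_posDef hδ g (n + 1)
  have h0 := h𝓗.gramOp_posDef hδ g n
  refine sub_posSemidef_of_sq h1.sqrt h0.sqrt fun x => ?_
  rw [h1.sqrtOp_mul_self, h0.sqrtOp_mul_self, gramOp_succ, add_sub_cancel_left]
  exact (h𝓗.posSemidef_hsProj (isPosSemidefOp_rankOneOp _)).2 x

/-- Concavity of `tr √` along the increment `A_{n+1} - A_n`, which is the projected rank-one term.
It is `two_mul_trace_le` with `H = A_{n+1}^{-1/2}`, `Q = A_n^{1/2}` and `η = 1`. -/
theorem inner_invSqrtOp_gramOp_le (n : ℕ) :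
    inner ℝ (g n) (invSqrtOp (gramOp 𝓗 δ g (n + 1)) (g n)) ≤
      2 * LinearMap.trace ℝ E (sqrtOp (gramOp 𝓗 δ g (n + 1))) -
        2 * LinearMap.trace ℝ E (sqrtOp (gramOp 𝓗 δ g n)) := by
  have h1 := h𝓗.gramOp_posDef hδ g (n + 1)
  have h0 := h𝓗.gramOp_posDef hδ g n
  have hT := invSqrtOp_gramOp_mem h𝓗 (δ := δ) g (n + 1)
  have e : hsProj 𝓗 (rankOneOp (g n) (g n)) = gramOp 𝓗 δ g (n + 1) - gramOp 𝓗 δ g n := by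
    rw [gramOp_succ, add_sub_cancel_left]
  rw [← hsInner_rankOneOp, ← hsInner_hsProj _ hT, e, hsInner_sub_right]
  have h2 := two_mul_trace_le h1.invSqrt h0.sqrt.1 1
  rw [h0.sqrtOp_mul_self, ← h1.inverse_sqrtOp, h1.sqrt.inverse_inverse] at h2
  have h3 : hsInner (invSqrtOp (gramOp 𝓗 δ g (n + 1))) (gramOp 𝓗 δ g (n + 1)) =
      LinearMap.trace ℝ E (sqrtOp (gramOp 𝓗 δ g (n + 1))) := by
    rw [hsInner_of_isSymmetric h1.1]
    conv_lhs => rw [← h1.sqrtOp_mul_self]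
    rw [h1.sqrtOp_mul_self, ← h1.inverse_sqrtOp]
    conv_lhs => enter [2, 2]; rw [← h1.sqrtOp_mul_self]
    rw [← mul_assoc, Ring.inverse_mul_cancel _ h1.sqrt.isUnit, one_mul]
  rw [h3, ← h1.inverse_sqrtOp]
  linarith

theorem sum_inner_invSqrtOp_gramOp_le (n : ℕ) :
    ∑ k ∈ Finset.range n, inner ℝ (g k) (invSqrtOp (gramOp 𝓗 δ g (k + 1)) (g k)) ≤
      2 * LinearMap.trace ℝ E (sqrtOp (gramOp 𝓗 δ g n)) := by
  induction n with
  | zero =>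
    have := trace_nonneg_of_posSemidef (h𝓗.gramOp_posDef hδ g 0).sqrt.posSemidef
    simpa using this
  | succ n ih =>
    rw [Finset.sum_range_succ]
    linarith [inner_invSqrtOp_gramOp_le h𝓗 hδ g n]

/-- Summation by parts: each increment of the weight is positive semidefinite and in `𝓗`, so it
costs at most `R²` times its trace, and the traces telescope. The final term, at `n + 1`, is kept on
the left because `w (n + 1)` carries no bound. -/
theorem sum_inner_sub_inner_le {R : ℝ} (w : ℕ → E) (n : ℕ)
    (hw : ∀ k ≤ n, precNorm 𝓗 (w k) ≤ R) :
    ∑ k ∈ Finset.range (n + 1), (inner ℝ (w k) (sqrtOp (gramOp 𝓗 δ g (k + 1)) (w k)) -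
        inner ℝ (w (k + 1)) (sqrtOp (gramOp 𝓗 δ g (k + 1)) (w (k + 1)))) +
      inner ℝ (w (n + 1)) (sqrtOp (gramOp 𝓗 δ g (n + 1)) (w (n + 1))) ≤
      R ^ 2 * LinearMap.trace ℝ E (sqrtOp (gramOp 𝓗 δ g (n + 1))) := by
  have bound : ∀ A ∈ 𝓗, IsPosSemidefOp A → ∀ y, precNorm 𝓗 y ≤ R →
      inner ℝ y (A y) ≤ R ^ 2 * LinearMap.trace ℝ E A := fun A hA hp y hy => by
    refine (inner_le_trace_mul_precNorm_sq hA hp y).trans ?_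
    rw [mul_comm]
    have := trace_nonneg_of_posSemidef hp
    have h0 : 0 ≤ precNorm 𝓗 y := Real.sqrt_nonneg _
    gcongr
  induction n with
  | zero =>
    have := bound _ (sqrtOp_gramOp_mem h𝓗 (δ := δ) g 1)
      (h𝓗.gramOp_posDef hδ g 1).sqrt.posSemidef (w 0) (hw 0 le_rfl)
    simpa using this
  | succ n ih =>
    have ih := ih fun k hk => hw k (by omega)
    have h1 := bound _ (𝓗.sub_mem (sqrtOp_gramOp_mem h𝓗 (δ := δ) g (n + 1 + 1))
      (sqrtOp_gramOp_mem h𝓗 g (n + 1))) (sub_sqrtOp_gramOp_posSemidef h𝓗 hδ g (n + 1))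
      (w (n + 1)) (hw (n + 1) le_rfl)
    rw [LinearMap.sub_apply, inner_sub_right, map_sub] at h1
    rw [Finset.sum_range_succ]
    linarith

/-- In `2 R ∑ ⟨g_k, x_k - x*⟩` the weighted distances contribute `R² tr A_{K+1}^{1/2}` and the
squared steps `2 R² tr A_{K+1}^{1/2}`; dividing by `2 R` leaves `3/2 R`. -/
theorem sum_inner_le_trace {R : ℝ} (hR : 0 < R) {K : ℕ} {x : ℕ → E} {xstar : E}
    (hrun : IsAdaptiveRun 𝓗 δ R K x g) (hx : ∀ k ≤ K, precNorm 𝓗 (x k - xstar) ≤ R) :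
    ∑ k ∈ Finset.range (K + 1), inner ℝ (g k) (x k - xstar) ≤
      3 / 2 * R * LinearMap.trace ℝ E (sqrtOp (gramOp 𝓗 δ g (K + 1))) := by
  rw [h𝓗.isAdaptiveRun_iff hδ hR] at hrun
  set w : ℕ → E := fun k => x k - xstar with hwdef
  have step : ∀ k ∈ Finset.range (K + 1), 2 * R * inner ℝ (g k) (w k) =
      (inner ℝ (w k) (sqrtOp (gramOp 𝓗 δ g (k + 1)) (w k)) -
        inner ℝ (w (k + 1)) (sqrtOp (gramOp 𝓗 δ g (k + 1)) (w (k + 1)))) +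
      R ^ 2 * inner ℝ (g k) (invSqrtOp (gramOp 𝓗 δ g (k + 1)) (g k)) := by
    intro k hk
    have h1 := h𝓗.gramOp_posDef hδ g (k + 1)
    set T := invSqrtOp (gramOp 𝓗 δ g (k + 1))
    set Q := sqrtOp (gramOp 𝓗 δ g (k + 1))
    have hw : w (k + 1) = w k - R • T (g k) := by
      simp only [hwdef]
      rw [hrun k (by simpa [Nat.lt_succ_iff] using hk)]
      abel
    have hQT : Q (T (g k)) = g k := by
      simp only [T, Q]
      rw [← h1.inverse_sqrtOp, h1.sqrt.apply_inverse]
    have h2 : inner ℝ (T (g k)) (Q (w k)) = inner ℝ (g k) (w k) := by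
      rw [← h1.sqrt.1, hQT]
    rw [hw]
    simp only [map_sub, map_smul, inner_sub_left, inner_sub_right, real_inner_smul_left,
      real_inner_smul_right, hQT, h2]
    rw [real_inner_comm (g k) (w k), real_inner_comm (g k) (T (g k))]
    ring
  have hsum := Finset.sum_congr rfl step
  rw [← Finset.mul_sum, Finset.sum_add_distrib, ← Finset.mul_sum] at hsum
  have h1 := sum_inner_sub_inner_le h𝓗 hδ g w K hx
  have h2 := sum_inner_invSqrtOp_gramOp_le h𝓗 hδ g (K + 1)
  have h3 := (h𝓗.gramOp_posDef hδ g (K + 1)).sqrt.posSemidef.2 (w (K + 1))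
  have h4 : 2 * R * ∑ k ∈ Finset.range (K + 1), inner ℝ (g k) (w k) ≤
      2 * R * (3 / 2 * R * LinearMap.trace ℝ E (sqrtOp (gramOp 𝓗 δ g (K + 1)))) := by
    nlinarith [mul_le_mul_of_nonneg_left h2 (sq_nonneg R)]
  exact le_of_mul_le_mul_left h4 (by positivity)

/-- `two_mul_trace_le` with `H = B⁻¹`. Since `B⁻¹ ∈ 𝓗`, the projection disappears from the pairing
and the weighted norms of the gradients remain. The comparison operator `B` is free. -/
theorem two_mul_trace_sqrtOp_gramOp_le {B : E →ₗ[ℝ] E} (hB : B ∈ 𝓗) (hp : IsPosDefOp B) (n : ℕ) :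
    2 * LinearMap.trace ℝ E (sqrtOp (gramOp 𝓗 δ g n)) ≤
      LinearMap.trace ℝ E B + δ * LinearMap.trace ℝ E (Ring.inverse B) +
        ∑ k ∈ Finset.range n, wNormSq (Ring.inverse B) (g k) := by
  have h1 := h𝓗.gramOp_posDef hδ g n
  have h2 := two_mul_trace_le hp.inverse h1.sqrt.1 1
  have hB' := h𝓗.inverse_mem hB hp
  rw [h1.sqrtOp_mul_self, hp.inverse_inverse, gramOp, hsInner_add_right, hsInner_smul_right,
    hsInner_hsProj _ hB', hsInner_sum_right, hsInner_comm _ 1] at h2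
  simp only [hsInner_rankOneOp] at h2
  have h3 : hsInner 1 (Ring.inverse B) = LinearMap.trace ℝ E (Ring.inverse B) := hsInner_id_left
  rw [h3] at h2
  rw [gramOp]
  simp only [wNormSq]
  linarith

end

/-- Cocoercivity at a minimizer of a matrix Hölder smooth convex function. -/
theorem IsMatrixHolder.le_inner_sub {f : E → ℝ} {L : E →ₗ[ℝ] E} {ν : ℝ}
    (hν : ν ∈ Set.Icc (0 : ℝ) 1) (hf : IsMatrixHolder f L ν) (hL : IsPosDefOp L) {xstar : E}
    (hmin : ∀ y, f xstar ≤ f y) {c m : ℝ} (hc : 0 < c) (hm : m = c ^ (-((1 - ν) / 2))) {x v : E}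
    (hv : IsSubgradientAt f x v) :
    f x - f xstar + wNormSq (Ring.inverse L) v / (2 * m) - m * c * trNorm L / 2 ≤
      inner ℝ v (x - xstar) := by
  obtain ⟨hν0, hν1⟩ := hν
  have hm0 : 0 < m := hm ▸ Real.rpow_pos_of_pos hc _
  set U := wNormSq (Ring.inverse L) v with hU
  have hU0 : 0 ≤ U := hL.inverse.posSemidef.2 v
  set T := trNorm L with hT
  have hT0 : 0 ≤ T := by
    rw [hT, trNorm_of_posDef hL]
    exact trace_nonneg_of_posSemidef hL.posSemidef
  -- The test point is `x* + u`: the subgradient inequality at `x` bounds `f` there from below, and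
  -- Hölder smoothness at `x*`, with subgradient `0`, bounds it from above.
  set u : E := (1 / m) • Ring.inverse L v with hu
  have h1 := hv (xstar + u)
  have h2 := (hf.2 xstar 0 (fun y => by simpa using hmin y) (xstar + u)).2
  rw [add_sub_cancel_left, inner_zero_left, sub_zero] at h2
  have hq : wNormSq L u = U / m ^ 2 := by
    rw [wNormSq, hu, map_smul, hL.apply_inverse, real_inner_smul_left, real_inner_smul_right,
      real_inner_comm, hU, wNormSq]
    field_simp
  have hvu : inner ℝ v u = U / m := by
    rw [hu, real_inner_smul_right, hU, wNormSq]
    ring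
  have hpow : wNorm L u ^ (1 + ν) = (U / m ^ 2) ^ ((1 + ν) / 2) := by
    rw [wNorm, hq, Real.sqrt_eq_rpow, ← Real.rpow_mul (by positivity)]
    congr 1
    ring
  -- The Hölder remainder becomes quadratic by weighted AM-GM; `m` is the power of `c` for which `T
  -- ^ ((1 - ν) / 2) = m (T c) ^ ((1 - ν) / 2)`.
  have hamgm := Real.geom_mean_le_arith_mean2_weighted (w₁ := (1 - ν) / 2) (w₂ := (1 + ν) / 2)
    (p₁ := T * c) (p₂ := U / m ^ 2) (by linarith) (by linarith) (by positivity) (by positivity)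
    (by ring)
  have hmc : T ^ ((1 - ν) / 2) = m * (T * c) ^ ((1 - ν) / 2) := by
    rw [Real.mul_rpow hT0 hc.le, hm, Real.rpow_neg hc.le]
    have : c ^ ((1 - ν) / 2) ≠ 0 := (Real.rpow_pos_of_pos hc _).ne'
    field_simp
  rw [hpow, hmc] at h2
  have h3 : 1 / (1 + ν) * (m * (T * c) ^ ((1 - ν) / 2)) * (U / m ^ 2) ^ ((1 + ν) / 2) ≤
      m * c * T / 2 + U / (2 * m) := by
    calc _ = m / (1 + ν) * ((T * c) ^ ((1 - ν) / 2) * (U / m ^ 2) ^ ((1 + ν) / 2)) := by ring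
      _ ≤ m / (1 + ν) * ((1 - ν) / 2 * (T * c) + (1 + ν) / 2 * (U / m ^ 2)) := by
        gcongr
      _ = (1 - ν) / (1 + ν) * (m * c * T / 2) + U / (2 * m) := by
        have : 1 + ν ≠ 0 := by linarith
        field_simp
      _ ≤ _ := by
        have : (1 - ν) / (1 + ν) ≤ 1 := (div_le_one (by linarith)).2 (by linarith)
        have h0 : 0 ≤ m * c * T / 2 := by positivity
        nlinarith
  have h4 : xstar + u - x = u - (x - xstar) := by abel
  rw [h4, inner_sub_right, hvu] at h1
  have h5 : U / m = U / (2 * m) + U / (2 * m) := by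
    field_simp
    ring
  linarith

/-- The pathwise bound from which the convergence rate follows by taking expectations. -/
theorem IsPreconditionerSpace.sum_gap_add_noise_le {𝓗 : Submodule ℝ (E →ₗ[ℝ] E)}
    (h𝓗 : IsPreconditionerSpace 𝓗) {δ R : ℝ} (hδ : 0 < δ) (hR : 0 < R) {f : E → ℝ} {xstar : E}
    (hmin : ∀ y, f xstar ≤ f y) {ν : ℝ} (hν : ν ∈ Set.Icc (0 : ℝ) 1) {L : E →ₗ[ℝ] E}
    (hL : L ∈ 𝓗 ∧ IsPosDefOp L) (hf : IsMatrixHolder f L ν) {gradf : E → E}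
    (hgrad : ∀ y, IsSubgradientAt f y (gradf y)) {Sig : E →ₗ[ℝ] E}
    (hSig : Sig ∈ 𝓗 ∧ IsPosDefOp Sig) {K : ℕ} {x g : ℕ → E}
    (hrun : IsAdaptiveRun 𝓗 δ R K x g) (hx : ∀ k ≤ K, precNorm 𝓗 (x k - xstar) ≤ R)
    {m : ℝ} (hm : m = (R ^ 2 / ((K : ℝ) + 1)) ^ (-((1 - ν) / 2))) :
    ∑ k ∈ Finset.range (K + 1), (f (x k) - f xstar) +
        ∑ k ∈ Finset.range (K + 1), inner ℝ (g k - gradf (x k)) (x k - xstar) ≤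
      3 / 2 * R * √δ * Module.finrank ℝ E + 13 / 8 * R ^ 2 * m * trNorm L +
        3 / 4 * R * √((K : ℝ) + 1) * trNorm Sig +
        3 / 4 * R / √((K : ℝ) + 1) *
          ∑ k ∈ Finset.range (K + 1), wNormSq (Ring.inverse Sig) (g k - gradf (x k)) := by
  have hN : (0 : ℝ) < (K : ℝ) + 1 := by positivity
  set N : ℝ := (K : ℝ) + 1 with hNdef
  have hc : 0 < R ^ 2 / N := by positivity
  have hm0 : 0 < m := hm ▸ Real.rpow_pos_of_pos hc _
  set T := trNorm L with hT
  set S := trNorm Sig with hS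
  -- Chosen so that `3/4 R · U / a = U / (2 m)`, exactly the gradient term gained from cocoercivity.
  set a : ℝ := 3 / 2 * R * m with ha
  have ha0 : 0 < a := by positivity
  have hb0 : 0 < √N := Real.sqrt_pos.2 hN
  have hs0 : 0 < √δ := Real.sqrt_pos.2 hδ
  set B : E →ₗ[ℝ] E := √δ • 1 + (a • L + √N • Sig) with hB
  have hBmem : B ∈ 𝓗 := 𝓗.add_mem (𝓗.smul_mem _ h𝓗.one_mem)
    (𝓗.add_mem (𝓗.smul_mem _ hL.1) (𝓗.smul_mem _ hSig.1))
  have hq : ∀ h : E, inner ℝ h (B h) =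
      √δ * ‖h‖ ^ 2 + (a * inner ℝ h (L h) + √N * inner ℝ h (Sig h)) := fun h => by
    simp [hB, inner_add_right, real_inner_smul_right]
  have hBpos : IsPosDefOp B := (isPosDefOp_id.smul hs0).add_posSemidef
    ((hL.2.smul ha0).add_posSemidef (hSig.2.smul hb0).posSemidef).posSemidef
  have hL0 := hL.2.posSemidef.2
  have hSig0 := hSig.2.posSemidef.2
  have htrB : LinearMap.trace ℝ E B = √δ * Module.finrank ℝ E + a * T + √N * S := by
    rw [hB, map_add, map_add, map_smul, map_smul, map_smul, trace_one_eq_finrank, hT, hS,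
      trNorm_of_posDef hL.2, trNorm_of_posDef hSig.2, smul_eq_mul, smul_eq_mul, smul_eq_mul]
    ring
  -- The summand `√δ I` of `B` balances `tr B` against `δ tr B⁻¹`: each then contributes `√δ` times
  -- the dimension.
  have htrB' : δ * LinearMap.trace ℝ E (Ring.inverse B) ≤ √δ * Module.finrank ℝ E := by
    have h := mul_trace_inverse_le hBpos hs0 fun h => by
      rw [hq]
      have := mul_nonneg ha0.le (hL0 h)
      have := mul_nonneg hb0.le (hSig0 h)
      linarith
    calc _ = √δ * (√δ * LinearMap.trace ℝ E (Ring.inverse B)) := by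
          rw [← mul_assoc, Real.mul_self_sqrt hδ.le]
      _ ≤ _ := mul_le_mul_of_nonneg_left h hs0.le
  have h1 := sum_inner_le_trace h𝓗 hδ g hR hrun hx
  have h2 := two_mul_trace_sqrtOp_gramOp_le h𝓗 hδ g hBmem hBpos (K + 1)
  have h3 : ∑ k ∈ Finset.range (K + 1), wNormSq (Ring.inverse B) (g k) ≤
      (∑ k ∈ Finset.range (K + 1), wNormSq (Ring.inverse L) (gradf (x k))) / a +
        (∑ k ∈ Finset.range (K + 1), wNormSq (Ring.inverse Sig) (g k - gradf (x k))) / √N := by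
    rw [Finset.sum_div, Finset.sum_div, ← Finset.sum_add_distrib]
    refine Finset.sum_le_sum fun k _ => ?_
    have := wNormSq_inverse_add_le hBpos hL.2 hSig.2 ha0 hb0 (fun h => by
      rw [hq]
      have : 0 ≤ √δ * ‖h‖ ^ 2 := by positivity
      linarith) (gradf (x k)) (g k - gradf (x k))
    rwa [add_sub_cancel] at this
  have h4 : ∑ k ∈ Finset.range (K + 1), (f (x k) - f xstar) +
      (∑ k ∈ Finset.range (K + 1), wNormSq (Ring.inverse L) (gradf (x k))) / (2 * m) -
        m * R ^ 2 * T / 2 ≤ ∑ k ∈ Finset.range (K + 1), inner ℝ (gradf (x k)) (x k - xstar) := by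
    have h := Finset.sum_le_sum fun k (_ : k ∈ Finset.range (K + 1)) =>
      hf.le_inner_sub hν hL.2 hmin hc hm (hgrad (x k))
    rw [Finset.sum_sub_distrib, Finset.sum_add_distrib, ← Finset.sum_div, Finset.sum_const,
      Finset.card_range, nsmul_eq_mul] at h
    have e : ((K + 1 : ℕ) : ℝ) * (m * (R ^ 2 / N) * T / 2) = m * R ^ 2 * T / 2 := by
      rw [Nat.cast_succ, ← hNdef]
      field_simp
    rw [← hT, e] at h
    exact h
  have h5 : ∑ k ∈ Finset.range (K + 1), inner ℝ (g k) (x k - xstar) =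
      ∑ k ∈ Finset.range (K + 1), inner ℝ (gradf (x k)) (x k - xstar) +
        ∑ k ∈ Finset.range (K + 1), inner ℝ (g k - gradf (x k)) (x k - xstar) := by
    rw [← Finset.sum_add_distrib]
    refine Finset.sum_congr rfl fun k _ => ?_
    rw [inner_sub_left]
    ring
  set U := ∑ k ∈ Finset.range (K + 1), wNormSq (Ring.inverse L) (gradf (x k))
  set V := ∑ k ∈ Finset.range (K + 1), wNormSq (Ring.inverse Sig) (g k - gradf (x k))
  have h6 : 3 / 2 * R * LinearMap.trace ℝ E (sqrtOp (gramOp 𝓗 δ g (K + 1))) ≤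
      3 / 4 * R * (2 * √δ * Module.finrank ℝ E + a * T + √N * S + (U / a + V / √N)) := by
    have : 2 * LinearMap.trace ℝ E (sqrtOp (gramOp 𝓗 δ g (K + 1))) ≤
      2 * √δ * Module.finrank ℝ E + a * T + √N * S + (U / a + V / √N) := by linarith
    nlinarith
  have h7 : 3 / 4 * R * (2 * √δ * Module.finrank ℝ E + a * T + √N * S + (U / a + V / √N)) =
      3 / 2 * R * √δ * Module.finrank ℝ E + 9 / 8 * R ^ 2 * m * T + 3 / 4 * R * √N * S +
        U / (2 * m) + 3 / 4 * R / √N * V := by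
    rw [ha]
    field_simp
    ring
  -- The terms `U / (2 m)` cancel, and `9/8 + 1/2 = 13/8` is the constant of the smooth part.
  linarith

end Regret

/-! ### Measurability of the iterates. -/

section Measurability

variable {E : Type*} [NormedAddCommGroup E] [InnerProductSpace ℝ E] [FiniteDimensional ℝ E]

/-! ### Continuity of the preconditioned gradient -/

theorem IsPosDefOp.sqrt_mul_norm_sq_le {A : E →ₗ[ℝ] E} (hA : IsPosDefOp A) {δ : ℝ}
    (hδ : ∀ x, δ * ‖x‖ ^ 2 ≤ inner ℝ x (A x)) (x : E) :
    √δ * ‖x‖ ^ 2 ≤ inner ℝ x (sqrtOp A x) := by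
  obtain ⟨b, l, h⟩ := hA.1.exists_eigenbasis
  have hl : ∀ i, δ ≤ l i := fun i => by
    have := hδ (b i)
    rw [h, real_inner_smul_right, real_inner_self_eq_norm_sq, b.orthonormal.1 i] at this
    simpa using this
  have hs : ∀ i, sqrtOp A (b i) = √(l i) • b i := opFun_apply_eigenbasis b h _
  rw [inner_apply_eq_sum_of_eigenbasis b hs, ← b.sum_sq_norm_inner_right x, Finset.mul_sum]
  refine Finset.sum_le_sum fun i _ => ?_
  rw [Real.norm_eq_abs, sq_abs, sq]
  exact mul_le_mul_of_nonneg_right (Real.sqrt_le_sqrt (hl i)) (mul_self_nonneg _)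

theorem IsPosDefOp.norm_inverse_apply_le {Q : E →ₗ[ℝ] E} (hQ : IsPosDefOp Q) {s : ℝ} (hs : 0 < s)
    (h : ∀ x, s * ‖x‖ ^ 2 ≤ inner ℝ x (Q x)) (z : E) : ‖Ring.inverse Q z‖ ≤ ‖z‖ / s := by
  have h1 := (h (Ring.inverse Q z)).trans (real_inner_le_norm _ _)
  rw [hQ.apply_inverse] at h1
  rw [le_div_iff₀ hs]
  by_cases h0 : ‖Ring.inverse Q z‖ = 0
  · rw [h0, zero_mul]
    exact norm_nonneg z
  · have hpos : 0 < ‖Ring.inverse Q z‖ := lt_of_le_of_ne (norm_nonneg _) (Ne.symm h0)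
    refine le_of_mul_le_mul_left ?_ hpos
    linarith

variable {𝓗 : Submodule ℝ (E →ₗ[ℝ] E)} (h𝓗 : IsPreconditionerSpace 𝓗) {δ : ℝ} (hδ : 0 < δ)

theorem continuous_gramOp (𝓗 : Submodule ℝ (E →ₗ[ℝ] E)) (δ : ℝ) (n : ℕ) :
    Continuous fun g : ℕ → E => LinearMap.toContinuousLinearMap (gramOp 𝓗 δ g n) := by
  let Φ : (E →L[ℝ] E) →ₗ[ℝ] (E →L[ℝ] E) :=
    LinearMap.toContinuousLinearMap.toLinearMap ∘ₗ hsProjₗ 𝓗 ∘ₗ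
      LinearMap.toContinuousLinearMap.symm.toLinearMap
  have hΦ : Continuous Φ := LinearMap.continuous_of_finiteDimensional Φ
  have h : (fun g : ℕ → E => LinearMap.toContinuousLinearMap (gramOp 𝓗 δ g n)) =
      fun g => LinearMap.toContinuousLinearMap (δ • (1 : E →ₗ[ℝ] E)) +
        ∑ i ∈ Finset.range n, Φ (InnerProductSpace.rankOne ℝ (g i) (g i)) := by
    funext g
    rw [gramOp_eq, map_add, map_sum]
    rfl
  rw [h]
  refine continuous_const.add (continuous_finsetSum _ fun i _ => hΦ.comp ?_)
  exact ((InnerProductSpace.rankOne ℝ (E := E) (F := E)).continuous.comp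
    (continuous_apply i)).clm_apply (continuous_apply i)

include h𝓗 hδ

theorem sqrt_mul_norm_sq_le_inner_sqrtOp_gramOp (g : ℕ → E) (n : ℕ) (x : E) :
    √δ * ‖x‖ ^ 2 ≤ inner ℝ x (sqrtOp (gramOp 𝓗 δ g n) x) := by
  refine (h𝓗.gramOp_posDef hδ g n).sqrt_mul_norm_sq_le (fun x => ?_) x
  rw [gramOp, LinearMap.add_apply, inner_add_right, LinearMap.smul_apply, real_inner_smul_right,
    Module.End.one_apply, real_inner_self_eq_norm_sq]
  have := (h𝓗.posSemidef_hsProj (isPosSemidefOp_sum (Finset.range n) fun i _ =>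
    isPosSemidefOp_rankOneOp (g i))).2 x
  linarith

/-- The square roots are bounded below by `√δ` uniformly in the gradients, so the Lipschitz estimate
transfers continuity from `gramOp`. -/
theorem continuous_sqrtOp_gramOp_apply (n : ℕ) (y : E) :
    Continuous fun g : ℕ → E => sqrtOp (gramOp 𝓗 δ g n) y := by
  rw [continuous_iff_continuousAt]
  intro g₀
  rw [ContinuousAt, tendsto_iff_norm_sub_tendsto_zero]
  have hc := (continuous_gramOp 𝓗 δ n).tendsto g₀
  rw [tendsto_iff_norm_sub_tendsto_zero] at hc
  have hc' := (hc.div_const (2 * √δ)).mul_const ‖y‖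
  rw [zero_div, zero_mul] at hc'
  refine squeeze_zero (fun _ => norm_nonneg _) (fun g => ?_) hc'
  have h1 := h𝓗.gramOp_posDef hδ g n
  have h0 := h𝓗.gramOp_posDef hδ g₀ n
  have := norm_sub_apply_le_of_sq h1.sqrt.1 h0.sqrt.1 (Real.sqrt_pos.2 hδ)
    (sqrt_mul_norm_sq_le_inner_sqrtOp_gramOp h𝓗 hδ g n)
    (sqrt_mul_norm_sq_le_inner_sqrtOp_gramOp h𝓗 hδ g₀ n) y
  rw [h1.sqrtOp_mul_self, h0.sqrtOp_mul_self, opNorm, map_sub] at this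
  exact this

/-- With `Q` the square root at the nearby point and `y` the value at the base point, `Q⁻¹ u - y =
Q⁻¹ (u - Q y)`, whose norm is at most `‖u - Q y‖ / √δ`. -/
theorem continuous_invSqrtOp_gramOp_apply (n : ℕ) :
    Continuous fun p : (ℕ → E) × E => invSqrtOp (gramOp 𝓗 δ p.1 n) p.2 := by
  rw [continuous_iff_continuousAt]
  rintro ⟨g₀, u₀⟩
  rw [ContinuousAt, tendsto_iff_norm_sub_tendsto_zero]
  set y := invSqrtOp (gramOp 𝓗 δ g₀ n) u₀ with hy
  have hQ : sqrtOp (gramOp 𝓗 δ g₀ n) y = u₀ := by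
    have h0 := h𝓗.gramOp_posDef hδ g₀ n
    rw [hy, ← h0.inverse_sqrtOp, h0.sqrt.apply_inverse]
  have hc : Filter.Tendsto
      (fun p : (ℕ → E) × E => ‖p.2 - sqrtOp (gramOp 𝓗 δ p.1 n) y‖ / √δ) (nhds (g₀, u₀))
      (nhds 0) := by
    have hcont : Continuous fun p : (ℕ → E) × E =>
        ‖p.2 - sqrtOp (gramOp 𝓗 δ p.1 n) y‖ / √δ :=
      ((continuous_snd.sub ((continuous_sqrtOp_gramOp_apply h𝓗 hδ n y).comp
        continuous_fst)).norm).div_const _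
    have := hcont.tendsto (g₀, u₀)
    simpa [hQ] using this
  refine squeeze_zero (fun _ => norm_nonneg _) (fun p => ?_) hc
  have h1 := h𝓗.gramOp_posDef hδ p.1 n
  have e : invSqrtOp (gramOp 𝓗 δ p.1 n) p.2 - y =
      Ring.inverse (sqrtOp (gramOp 𝓗 δ p.1 n)) (p.2 - sqrtOp (gramOp 𝓗 δ p.1 n) y) := by
    rw [map_sub, h1.sqrt.inverse_apply, h1.inverse_sqrtOp]
  rw [e]
  exact h1.sqrt.norm_inverse_apply_le (Real.sqrt_pos.2 hδ)
    (sqrt_mul_norm_sq_le_inner_sqrtOp_gramOp h𝓗 hδ p.1 n) _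

theorem measurable_invSqrtOp_gramOp_apply [MeasurableSpace E] [BorelSpace E] {Ω : Type*}
    [MeasurableSpace Ω] {v : ℕ → Ω → E} {n : ℕ} (hv : ∀ i < n, Measurable (v i)) {u : Ω → E}
    (hu : Measurable u) :
    Measurable fun ω => invSqrtOp (gramOp 𝓗 δ (fun i => v i ω) n) (u ω) := by
  -- Only the first `n` entries are known to be measurable and only they enter `gramOp`; the others
  -- are replaced by zero.
  let w : Ω → ℕ → E := fun ω i => if i < n then v i ω else 0
  have hw : Measurable w := by
    refine measurable_pi_lambda _ fun i => ?_
    by_cases hi : i < n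
    · simpa [w, hi] using hv i hi
    · simp [w, hi]
  have h : (fun ω => invSqrtOp (gramOp 𝓗 δ (fun i => v i ω) n) (u ω)) =
      (fun p : (ℕ → E) × E => invSqrtOp (gramOp 𝓗 δ p.1 n) p.2) ∘ fun ω => (w ω, u ω) := by
    funext ω
    simp only [Function.comp_apply, gramOp]
    have hsum : ∑ i ∈ Finset.range n, rankOneOp (v i ω) (v i ω) =
        ∑ i ∈ Finset.range n, rankOneOp (w ω i) (w ω i) :=
      Finset.sum_congr rfl fun i hi => by simp [w, Finset.mem_range.1 hi]
    rw [hsum]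
  rw [h]
  exact (continuous_invSqrtOp_gramOp_apply h𝓗 hδ n).measurable.comp (hw.prodMk hu)

/-- The iterates are adapted to the natural filtration of the samples. -/
theorem measurable_iterate [MeasurableSpace E] [BorelSpace E] {Ω Z : Type*} [MeasurableSpace Z]
    {R : ℝ} (hR : 0 < R) {K : ℕ} {G : E → Z → E} (hG : Measurable (Function.uncurry G))
    {x₀ : E} {x : ℕ → Ω → E} {ξ : ℕ → Ω → Z} (hx₀ : ∀ ω, x 0 ω = x₀)
    (hrun : ∀ ω, IsAdaptiveRun 𝓗 δ R K (fun k => x k ω) (fun k => G (x k ω) (ξ k ω)))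
    (m : ℕ → MeasurableSpace Ω) (hmono : Monotone m)
    (hξ : ∀ k ≤ K, Measurable[m (k + 1)] (ξ k)) (k : ℕ) (hk : k ≤ K + 1) :
    Measurable[m k] (x k) := by
  induction k using Nat.strong_induction_on with
  | _ k ih =>
    cases k with
    | zero =>
      have : x 0 = fun _ => x₀ := funext hx₀
      rw [this]
      exact measurable_const
    | succ k =>
      have hx : ∀ i ≤ k, Measurable[m (k + 1)] (x i) := fun i hi =>
        (ih i (by omega) (by omega)).mono (hmono (by omega)) le_rfl
      have hg : ∀ i ≤ k, Measurable[m (k + 1)] fun ω => G (x i ω) (ξ i ω) := fun i hi =>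
        hG.comp ((hx i hi).prodMk ((hξ i (by omega)).mono (hmono (by omega)) le_rfl))
      have hstep : x (k + 1) = fun ω => x k ω -
          R • invSqrtOp (gramOp 𝓗 δ (fun i => G (x i ω) (ξ i ω)) (k + 1)) (G (x k ω) (ξ k ω)) :=
        funext fun ω => (h𝓗.isAdaptiveRun_iff hδ hR K _ _).1 (hrun ω) k (by omega)
      rw [hstep]
      let := m (k + 1)
      exact (hx k le_rfl).sub ((measurable_invSqrtOp_gramOp_apply h𝓗 hδ
        (v := fun i ω => G (x i ω) (ξ i ω)) (fun i hi => hg i (by omega))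
        (hg k le_rfl)).const_smul R)

end Measurability

/-! ### Independence, integrability and the expected rate. -/

section Expectation

variable {E : Type*} [NormedAddCommGroup E] [InnerProductSpace ℝ E] [FiniteDimensional ℝ E]
  [MeasurableSpace E] [BorelSpace E] {Z : Type*} [MeasurableSpace Z] {D : Measure Z}
  [IsProbabilityMeasure D] {Ω : Type*} [MeasurableSpace Ω] {P : Measure Ω}
  [IsProbabilityMeasure P]

/-! ### Stochastic gradients at independent points -/

/-- An iterate that is measurable with respect to the previous samples is independent of the
current sample. -/
theorem indepFun_of_measurable_iSup_comap {K : ℕ} {ξ : ℕ → Ω → Z}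
    (hξ : ∀ k ≤ K, Measurable (ξ k)) (hind : iIndepFun (fun k : Fin (K + 1) => ξ k) P)
    {k : ℕ} (hk : k ≤ K) {y : Ω → E}
    (hy : Measurable[⨆ i : Fin (K + 1), ⨆ _ : (i : ℕ) < k,
      MeasurableSpace.comap (ξ i) inferInstance] y) : IndepFun y (ξ k) P := by
  have hdisj : Disjoint {i : Fin (K + 1) | (i : ℕ) < k} {⟨k, Nat.lt_succ_of_le hk⟩} := by
    rw [Set.disjoint_singleton_right]
    simp
  have h := indep_iSup_of_disjoint
    (m := fun i : Fin (K + 1) => MeasurableSpace.comap (ξ i) inferInstance)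
    (fun i => (hξ i (Nat.le_of_lt_succ i.2)).comap_le) hind.iIndep hdisj
  rw [IndepFun_iff_Indep]
  refine indep_of_indep_of_le_left (indep_of_indep_of_le_right h ?_) hy.comap_le
  exact le_iSup₂_of_le (⟨k, Nat.lt_succ_of_le hk⟩ : Fin (K + 1)) rfl le_rfl

theorem continuous_wNormSq (A : E →ₗ[ℝ] E) : Continuous (wNormSq A) :=
  continuous_id.inner A.continuous_of_finiteDimensional

namespace IsStochasticGradient

variable {gradf : E → E} {G : E → Z → E} {Sig : E →ₗ[ℝ] E}

/-- Measurability of the chosen subgradients is inherited from `G`, because unbiasedness makes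
`gradf` a parametric integral of it. -/
theorem measurable_gradient (h : IsStochasticGradient D gradf G Sig) : Measurable gradf := by
  have hG : Measurable fun x => ∫ ζ, G x ζ ∂D :=
    (StronglyMeasurable.integral_prod_right (f := G) h.1.stronglyMeasurable).measurable
  have e : gradf = fun x => ∫ ζ, G x ζ ∂D := by
    funext x
    obtain ⟨hi, h0⟩ := (h.2 x).1
    have h1 : ∫ ζ, G x ζ ∂D = ∫ ζ, ((G x ζ - gradf x) + gradf x) ∂D := by simp
    rw [h1, integral_add hi (integrable_const _), h0]
    simp
  rw [e]
  exact hG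

theorem measurable_noise (h : IsStochasticGradient D gradf G Sig) :
    Measurable fun p : E × Z => G p.1 p.2 - gradf p.1 :=
  h.1.sub (h.measurable_gradient.comp measurable_fst)

theorem measurable_wNormSq_noise (h : IsStochasticGradient D gradf G Sig) :
    Measurable fun p : E × Z => wNormSq (Ring.inverse Sig) (G p.1 p.2 - gradf p.1) :=
  (continuous_wNormSq _).measurable.comp h.measurable_noise

theorem integrable_wNormSq_noise_prod (h : IsStochasticGradient D gradf G Sig)
    (hSig : IsPosDefOp Sig) (μ : Measure E) [IsProbabilityMeasure μ] :
    Integrable (fun p : E × Z => wNormSq (Ring.inverse Sig) (G p.1 p.2 - gradf p.1))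
      (μ.prod D) := by
  have hm := h.measurable_wNormSq_noise
  rw [integrable_prod_iff hm.aestronglyMeasurable]
  refine ⟨Filter.Eventually.of_forall fun x => (h.2 x).2.1, ?_⟩
  refine Integrable.of_bound (C := trNorm Sig) ?_ (Filter.Eventually.of_forall fun x => ?_)
  · exact (StronglyMeasurable.integral_prod_right
      (f := fun x ζ => ‖wNormSq (Ring.inverse Sig) (G x ζ - gradf x)‖)
      hm.norm.stronglyMeasurable).aestronglyMeasurable
  · have hnn : ∀ ζ, 0 ≤ wNormSq (Ring.inverse Sig) (G x ζ - gradf x) := fun ζ =>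
      hSig.inverse.posSemidef.2 _
    simp only [Real.norm_of_nonneg (hnn _)]
    rw [Real.norm_of_nonneg (integral_nonneg hnn)]
    exact (h.2 x).2.2

variable {ξ : Ω → Z} {y : Ω → E}

theorem integrable_wNormSq_noise (h : IsStochasticGradient D gradf G Sig) (hSig : IsPosDefOp Sig)
    (hξ : Measurable ξ) (hD : P.map ξ = D) (hy : Measurable y) (hind : IndepFun y ξ P) :
    Integrable (fun ω => wNormSq (Ring.inverse Sig) (G (y ω) (ξ ω) - gradf (y ω))) P := by
  have hlaw := (indepFun_iff_map_prod_eq_prod_map_map hy.aemeasurable hξ.aemeasurable).1 hind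
  have := Measure.isProbabilityMeasure_map (μ := P) hy.aemeasurable
  have hint := h.integrable_wNormSq_noise_prod hSig (P.map y)
  rw [← hD, ← hlaw] at hint
  exact (integrable_map_measure h.measurable_wNormSq_noise.aestronglyMeasurable
    (hy.prodMk hξ).aemeasurable).1 hint

theorem integral_wNormSq_noise_le (h : IsStochasticGradient D gradf G Sig)
    (hSig : IsPosDefOp Sig) (hξ : Measurable ξ) (hD : P.map ξ = D) (hy : Measurable y)
    (hind : IndepFun y ξ P) :
    ∫ ω, wNormSq (Ring.inverse Sig) (G (y ω) (ξ ω) - gradf (y ω)) ∂P ≤ trNorm Sig := by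
  have hlaw := (indepFun_iff_map_prod_eq_prod_map_map hy.aemeasurable hξ.aemeasurable).1 hind
  rw [hD] at hlaw
  have := Measure.isProbabilityMeasure_map (μ := P) hy.aemeasurable
  have hint := h.integrable_wNormSq_noise_prod hSig (P.map y)
  have e : ∫ ω, wNormSq (Ring.inverse Sig) (G (y ω) (ξ ω) - gradf (y ω)) ∂P =
      ∫ p, wNormSq (Ring.inverse Sig) (G p.1 p.2 - gradf p.1) ∂((P.map y).prod D) := by
    rw [← hlaw, integral_map (hy.prodMk hξ).aemeasurable
      h.measurable_wNormSq_noise.aestronglyMeasurable]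
  rw [e, integral_prod _ hint]
  calc _ ≤ ∫ _x, trNorm Sig ∂(P.map y) :=
        integral_mono hint.integral_prod_left (integrable_const _) fun x => (h.2 x).2.2
    _ = trNorm Sig := by simp

/-- Young's inequality for both signs dominates the pairing by the `Σ⁻¹`-norm of the noise, which is
square integrable, and the bounded `Σ`-norm of `y - z`. -/
theorem integrable_inner_noise (h : IsStochasticGradient D gradf G Sig) (hSig : IsPosDefOp Sig)
    (hξ : Measurable ξ) (hD : P.map ξ = D) (hy : Measurable y) (hind : IndepFun y ξ P)
    {z : E} {C : ℝ} (hC : ∀ᵐ ω ∂P, wNormSq Sig (y ω - z) ≤ C) :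
    Integrable (fun ω => inner ℝ (G (y ω) (ξ ω) - gradf (y ω)) (y ω - z)) P := by
  have hV := h.integrable_wNormSq_noise hSig hξ hD hy hind
  refine Integrable.mono' (hV.add (integrable_const C)) ?_ ?_
  · exact ((h.measurable_noise.comp (hy.prodMk hξ)).inner
      (hy.sub_const z)).aestronglyMeasurable
  · filter_upwards [hC] with ω hω
    have h1 := two_mul_inner_le_wNormSq hSig one_pos (G (y ω) (ξ ω) - gradf (y ω)) (y ω - z)
    have h2 := two_mul_inner_le_wNormSq hSig one_pos (G (y ω) (ξ ω) - gradf (y ω)) (-(y ω - z))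
    rw [inner_neg_right, map_neg, inner_neg_neg] at h2
    have h3 : 0 ≤ wNormSq (Ring.inverse Sig) (G (y ω) (ξ ω) - gradf (y ω)) :=
      hSig.inverse.posSemidef.2 _
    have h4 : 0 ≤ wNormSq Sig (y ω - z) := hSig.posSemidef.2 _
    rw [div_one, one_mul] at h1 h2
    rw [wNormSq] at hω h4
    rw [Real.norm_eq_abs, abs_le]
    simp only [Pi.add_apply]
    constructor <;> linarith

/-- By independence the joint law of `y` and `ξ` is a product, and Fubini reduces the claim to the
zero mean of the noise at each fixed point. -/
theorem integral_inner_noise_eq_zero (h : IsStochasticGradient D gradf G Sig)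
    (hSig : IsPosDefOp Sig) (hξ : Measurable ξ) (hD : P.map ξ = D) (hy : Measurable y)
    (hind : IndepFun y ξ P) {z : E} {C : ℝ} (hC : ∀ᵐ ω ∂P, wNormSq Sig (y ω - z) ≤ C) :
    ∫ ω, inner ℝ (G (y ω) (ξ ω) - gradf (y ω)) (y ω - z) ∂P = 0 := by
  have hlaw := (indepFun_iff_map_prod_eq_prod_map_map hy.aemeasurable hξ.aemeasurable).1 hind
  rw [hD] at hlaw
  have := Measure.isProbabilityMeasure_map (μ := P) hy.aemeasurable
  have hm : Measurable fun p : E × Z => inner ℝ (G p.1 p.2 - gradf p.1) (p.1 - z) :=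
    h.measurable_noise.inner (measurable_fst.sub_const z)
  have hint : Integrable (fun p : E × Z => inner ℝ (G p.1 p.2 - gradf p.1) (p.1 - z))
      ((P.map y).prod D) := by
    rw [← hlaw]
    exact (integrable_map_measure hm.aestronglyMeasurable (hy.prodMk hξ).aemeasurable).2
      (h.integrable_inner_noise hSig hξ hD hy hind hC)
  have e : ∫ ω, inner ℝ (G (y ω) (ξ ω) - gradf (y ω)) (y ω - z) ∂P =
      ∫ p, inner ℝ (G p.1 p.2 - gradf p.1) (p.1 - z) ∂((P.map y).prod D) := by
    rw [← hlaw, integral_map (hy.prodMk hξ).aemeasurable hm.aestronglyMeasurable]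
  rw [e, integral_prod _ hint]
  have h0 : ∀ x, ∫ ζ, inner ℝ (G x ζ - gradf x) (x - z) ∂D = 0 := fun x => by
    simp only [real_inner_comm (x - z)]
    rw [integral_inner (h.2 x).1.1, (h.2 x).1.2, inner_zero_right]
  simp [h0]

end IsStochasticGradient

/-- A continuous function of an almost surely bounded random vector is integrable. -/
theorem Continuous.integrable_comp_of_bounded {f : E → ℝ} (hf : Continuous f) {y : Ω → E}
    (hy : Measurable y) {z : E} {C : ℝ} (hC : ∀ᵐ ω ∂P, ‖y ω - z‖ ≤ C) :
    Integrable (fun ω => f (y ω)) P := by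
  obtain ⟨M, hM⟩ := (isCompact_closedBall z C).exists_bound_of_continuousOn hf.continuousOn
  refine Integrable.of_bound (hf.measurable.comp hy).aestronglyMeasurable M ?_
  filter_upwards [hC] with ω hω
  exact hM _ (mem_closedBall_iff_norm.2 hω)

theorem ConvexOn.map_average_range_le {f : E → ℝ} (hf : ConvexOn ℝ Set.univ f) (K : ℕ) (x : ℕ → E) :
    f ((1 / ((K : ℝ) + 1)) • ∑ k ∈ Finset.range (K + 1), x k) ≤
      1 / ((K : ℝ) + 1) * ∑ k ∈ Finset.range (K + 1), f (x k) := by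
  have h := hf.map_sum_le (t := Finset.range (K + 1)) (w := fun _ => 1 / ((K : ℝ) + 1)) (p := x)
    (fun _ _ => by positivity) (by
      rw [Finset.sum_const, Finset.card_range, nsmul_eq_mul, Nat.cast_succ]
      field_simp) (fun _ _ => Set.mem_univ _)
  rwa [← Finset.smul_sum, ← Finset.smul_sum, smul_eq_mul] at h

/-- The step-size constant of the smooth part, in the form in which it enters the rate. -/
theorem sq_mul_rpow_neg_div {R N ν : ℝ} (hR : 0 < R) (hN : 0 < N) :
    R ^ 2 * (R ^ 2 / N) ^ (-((1 - ν) / 2)) / N = R ^ (1 + ν) / N ^ ((1 + ν) / 2) := by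
  have h1 : (R ^ 2 / N) ^ (-((1 - ν) / 2)) = (R ^ 2 / N) ^ ((1 + ν) / 2) * (R ^ 2 / N)⁻¹ := by
    rw [← Real.rpow_neg_one, ← Real.rpow_add (by positivity)]
    congr 1
    ring
  have h2 : (R ^ 2) ^ ((1 + ν) / 2) = R ^ (1 + ν) := by
    rw [← Real.rpow_natCast, ← Real.rpow_mul hR.le]
    congr 1
    push_cast
    ring
  rw [h1, Real.div_rpow (by positivity) hN.le, h2]
  field_simp

end Expectation

/-- The expected function value gap of adaptive preconditioned SGD. -/
theorem IsPreconditionerSpace.integrable_gap_and_integral_gap_le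
    {E : Type*} [NormedAddCommGroup E] [InnerProductSpace ℝ E] [FiniteDimensional ℝ E]
    [MeasurableSpace E] [BorelSpace E] {Z : Type*} [MeasurableSpace Z] {D : Measure Z}
    [IsProbabilityMeasure D] {Ω : Type*} [MeasurableSpace Ω] {P : Measure Ω}
    [IsProbabilityMeasure P] {𝓗 : Submodule ℝ (E →ₗ[ℝ] E)} (h𝓗 : IsPreconditionerSpace 𝓗)
    {f : E → ℝ} {xstar : E} (hmin : ∀ y, f xstar ≤ f y) {ν : ℝ} (hν : ν ∈ Set.Icc (0 : ℝ) 1)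
    {L : E →ₗ[ℝ] E} (hL : L ∈ 𝓗 ∧ IsPosDefOp L) (hf : IsMatrixHolder f L ν)
    {gradf : E → E} (hgrad : ∀ y, IsSubgradientAt f y (gradf y))
    {Sig : E →ₗ[ℝ] E} (hSig : Sig ∈ 𝓗 ∧ IsPosDefOp Sig)
    {G : E → Z → E} (hG : IsStochasticGradient D gradf G Sig) {K : ℕ}
    {ξ : ℕ → Ω → Z} (hξ : ∀ k ≤ K, Measurable (ξ k) ∧ Measure.map (ξ k) P = D)
    (hind : iIndepFun (fun k : Fin (K + 1) => ξ k) P)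
    {δ R : ℝ} (hδ : 0 < δ) (hR : 0 < R) {x₀ : E} {x : ℕ → Ω → E} (hx₀ : ∀ ω, x 0 ω = x₀)
    (hrun : ∀ ω, IsAdaptiveRun 𝓗 δ R K (fun k => x k ω) (fun k => G (x k ω) (ξ k ω)))
    (hx : ∀ᵐ ω ∂P, ∀ k ≤ K, precNorm 𝓗 (x k ω - xstar) ≤ R) :
    Integrable
        (fun ω => f ((1 / ((K : ℝ) + 1)) • ∑ k ∈ Finset.range (K + 1), x k ω) - f xstar) P ∧
      ∫ ω, (f ((1 / ((K : ℝ) + 1)) • ∑ k ∈ Finset.range (K + 1), x k ω) - f xstar) ∂P ≤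
        3 * trNorm L * R ^ (1 + ν) / ((K : ℝ) + 1) ^ ((1 + ν) / 2) +
          3 * trNorm Sig * R / √((K : ℝ) + 1) +
          3 * √δ * R * (Module.finrank ℝ E : ℝ) / ((K : ℝ) + 1) := by
  -- Generated by the samples with index strictly below `k`: enough to determine `x k`, and
  -- independent of `ξ k`.
  let 𝓕 : ℕ → MeasurableSpace Ω := fun k =>
    ⨆ i : Fin (K + 1), ⨆ _ : (i : ℕ) < k, MeasurableSpace.comap (ξ i) inferInstance
  have h𝓕mono : Monotone 𝓕 := fun k l hkl =>
    iSup_mono fun i => iSup_mono' fun hi => ⟨hi.trans_le hkl, le_rfl⟩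
  have h𝓕ξ : ∀ k ≤ K, Measurable[𝓕 (k + 1)] (ξ k) := fun k hk =>
    (comap_measurable (ξ k)).mono (le_iSup₂_of_le (⟨k, Nat.lt_succ_of_le hk⟩ : Fin (K + 1))
      (Nat.lt_succ_self k) le_rfl) le_rfl
  have h𝓕le : ∀ k, 𝓕 k ≤ ‹MeasurableSpace Ω› := fun k =>
    iSup₂_le fun i _ => (hξ i (Nat.le_of_lt_succ i.2)).1.comap_le
  have hadapted : ∀ k ≤ K + 1, Measurable[𝓕 k] (x k) :=
    measurable_iterate h𝓗 hδ hR hG.1 hx₀ hrun 𝓕 h𝓕mono h𝓕ξ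
  have hmeas : ∀ k ≤ K, Measurable (x k) := fun k hk =>
    (hadapted k (by omega)).mono (h𝓕le k) le_rfl
  have hindep : ∀ k ≤ K, IndepFun (x k) (ξ k) P := fun k hk =>
    indepFun_of_measurable_iSup_comap (fun k hk => (hξ k hk).1) hind hk (hadapted k (by omega))
  have hN : (0 : ℝ) < (K : ℝ) + 1 := by positivity
  have hbdd : ∀ᵐ ω ∂P, ∀ k ≤ K, ‖x k ω - xstar‖ ≤ √(Module.finrank ℝ E * R ^ 2) := by
    filter_upwards [hx] with ω hω k hk
    refine Real.le_sqrt_of_sq_le ((h𝓗.norm_sq_le _).trans ?_)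
    have h0 : 0 ≤ precNorm 𝓗 (x k ω - xstar) := Real.sqrt_nonneg _
    have := hω k hk
    gcongr
  have hbddSig : ∀ k ≤ K, ∀ᵐ ω ∂P, wNormSq Sig (x k ω - xstar) ≤
      LinearMap.trace ℝ E Sig * R ^ 2 := fun k hk => by
    filter_upwards [hx] with ω hω
    refine (inner_le_trace_mul_precNorm_sq hSig.1 hSig.2.posSemidef _).trans ?_
    have h0 : 0 ≤ precNorm 𝓗 (x k ω - xstar) := Real.sqrt_nonneg _
    have := trace_nonneg_of_posSemidef hSig.2.posSemidef
    have := hω k hk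
    gcongr
  -- A finite convex function on a finite-dimensional space is continuous; with the bounded iterates
  -- this makes the gaps integrable.
  have hcont : Continuous f := continuousOn_univ.1 (hf.1.continuousOn isOpen_univ)
  have hgap : ∀ k ∈ Finset.range (K + 1), Integrable (fun ω => f (x k ω) - f xstar) P :=
    fun k hk => by
      have hk : k ≤ K := Nat.le_of_lt_succ (Finset.mem_range.1 hk)
      exact (hcont.integrable_comp_of_bounded (hmeas k hk)
        (hbdd.mono fun ω hω => hω k hk)).sub (integrable_const _)
  have hnoise : ∀ k ∈ Finset.range (K + 1), Integrable (fun ω =>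
      inner ℝ (G (x k ω) (ξ k ω) - gradf (x k ω)) (x k ω - xstar)) P := fun k hk => by
    have hk : k ≤ K := Nat.le_of_lt_succ (Finset.mem_range.1 hk)
    exact hG.integrable_inner_noise hSig.2 (hξ k hk).1 (hξ k hk).2 (hmeas k hk) (hindep k hk)
      (hbddSig k hk)
  have hvar : ∀ k ∈ Finset.range (K + 1), Integrable (fun ω =>
      wNormSq (Ring.inverse Sig) (G (x k ω) (ξ k ω) - gradf (x k ω))) P := fun k hk => by
    have hk : k ≤ K := Nat.le_of_lt_succ (Finset.mem_range.1 hk)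
    exact hG.integrable_wNormSq_noise hSig.2 (hξ k hk).1 (hξ k hk).2 (hmeas k hk) (hindep k hk)
  set m : ℝ := (R ^ 2 / ((K : ℝ) + 1)) ^ (-((1 - ν) / 2)) with hm
  have hpath : ∀ᵐ ω ∂P, ∑ k ∈ Finset.range (K + 1), (f (x k ω) - f xstar) +
      ∑ k ∈ Finset.range (K + 1),
        inner ℝ (G (x k ω) (ξ k ω) - gradf (x k ω)) (x k ω - xstar) ≤
      (3 / 2 * R * √δ * Module.finrank ℝ E + 13 / 8 * R ^ 2 * m * trNorm L +
        3 / 4 * R * √((K : ℝ) + 1) * trNorm Sig) +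
        3 / 4 * R / √((K : ℝ) + 1) * ∑ k ∈ Finset.range (K + 1),
          wNormSq (Ring.inverse Sig) (G (x k ω) (ξ k ω) - gradf (x k ω)) := by
    filter_upwards [hx] with ω hω
    exact h𝓗.sum_gap_add_noise_le hδ hR hmin hν hL hf hgrad hSig (hrun ω) hω hm
  have hexp := integral_mono_ae ((integrable_finsetSum _ hgap).add (integrable_finsetSum _ hnoise))
    ((integrable_const _).add ((integrable_finsetSum _ hvar).const_mul _)) hpath
  simp only [Pi.add_apply] at hexp
  rw [integral_add (integrable_finsetSum _ hgap) (integrable_finsetSum _ hnoise),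
    integral_add (integrable_const _) ((integrable_finsetSum _ hvar).const_mul _),
    integral_finsetSum _ hnoise, integral_const_mul, integral_finsetSum _ hvar, integral_const,
    Finset.sum_eq_zero fun k hk => by
      have hk : k ≤ K := Nat.le_of_lt_succ (Finset.mem_range.1 hk)
      exact hG.integral_inner_noise_eq_zero hSig.2 (hξ k hk).1 (hξ k hk).2 (hmeas k hk)
        (hindep k hk) (hbddSig k hk)] at hexp
  have hsumvar : ∑ k ∈ Finset.range (K + 1),
      ∫ ω, wNormSq (Ring.inverse Sig) (G (x k ω) (ξ k ω) - gradf (x k ω)) ∂P ≤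
        ((K : ℝ) + 1) * trNorm Sig := by
    refine (Finset.sum_le_card_nsmul _ _ (trNorm Sig) fun k hk => ?_).trans ?_
    · have hk : k ≤ K := Nat.le_of_lt_succ (Finset.mem_range.1 hk)
      exact hG.integral_wNormSq_noise_le hSig.2 (hξ k hk).1 (hξ k hk).2 (hmeas k hk)
        (hindep k hk)
    · simp
  have hgapavg := (integrable_finsetSum _ hgap).const_mul (1 / ((K : ℝ) + 1))
  have hjensen : ∀ ω, f ((1 / ((K : ℝ) + 1)) • ∑ k ∈ Finset.range (K + 1), x k ω) - f xstar ≤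
      1 / ((K : ℝ) + 1) * ∑ k ∈ Finset.range (K + 1), (f (x k ω) - f xstar) := fun ω => by
    have h := hf.1.map_average_range_le K fun k => x k ω
    rw [Finset.sum_sub_distrib, Finset.sum_const, Finset.card_range, nsmul_eq_mul, Nat.cast_succ,
      mul_sub, ← mul_assoc, one_div_mul_cancel hN.ne', one_mul]
    linarith
  have hint : Integrable
      (fun ω => f ((1 / ((K : ℝ) + 1)) • ∑ k ∈ Finset.range (K + 1), x k ω) - f xstar) P := by
    -- By minimality and Jensen the gap at the average lies between zero and the average of the
    -- integrable gaps.
    refine hgapavg.mono' ?_ (Filter.Eventually.of_forall fun ω => ?_)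
    · have hsum : Measurable fun ω => ∑ k ∈ Finset.range (K + 1), x k ω :=
        Finset.measurable_fun_sum _ fun k hk =>
          hmeas k (Nat.le_of_lt_succ (Finset.mem_range.1 hk))
      exact ((hcont.measurable.comp (hsum.const_smul _)).sub_const _).aestronglyMeasurable
    · rw [Real.norm_of_nonneg (sub_nonneg.2 (hmin _))]
      exact hjensen ω
  refine ⟨hint, (integral_mono hint hgapavg hjensen).trans ?_⟩
  rw [integral_const_mul]
  have hsq := Real.mul_self_sqrt hN.le
  have hs0 : 0 < √((K : ℝ) + 1) := Real.sqrt_pos.2 hN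
  have hT0 : 0 ≤ trNorm L := by
    rw [trNorm_of_posDef hL.2]
    exact trace_nonneg_of_posSemidef hL.2.posSemidef
  have hS0 : 0 ≤ trNorm Sig := by
    rw [trNorm_of_posDef hSig.2]
    exact trace_nonneg_of_posSemidef hSig.2.posSemidef
  have hbound : ∫ ω, ∑ k ∈ Finset.range (K + 1), (f (x k ω) - f xstar) ∂P ≤
      3 / 2 * R * √δ * Module.finrank ℝ E + 13 / 8 * R ^ 2 * m * trNorm L +
        3 / 2 * R * √((K : ℝ) + 1) * trNorm Sig := by
    have h1 := mul_le_mul_of_nonneg_left hsumvar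
      (by positivity : 0 ≤ 3 / 4 * R / √((K : ℝ) + 1))
    have h2 : 3 / 4 * R / √((K : ℝ) + 1) * (((K : ℝ) + 1) * trNorm Sig) =
        3 / 4 * R * √((K : ℝ) + 1) * trNorm Sig := by
      conv_lhs => rw [← hsq]
      field_simp
      rw [Real.sqrt_sq hs0.le]
    simp only [probReal_univ, one_smul] at hexp
    linarith
  have hrate := sq_mul_rpow_neg_div (ν := ν) hR hN
  rw [← hm] at hrate
  have hrate0 : 0 ≤ R ^ (1 + ν) / ((K : ℝ) + 1) ^ ((1 + ν) / 2) := by positivity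
  have hnoise_rate : √((K : ℝ) + 1) / ((K : ℝ) + 1) = 1 / √((K : ℝ) + 1) := by
    rw [div_eq_div_iff hN.ne' hs0.ne', hsq, one_mul]
  calc _ ≤ 1 / ((K : ℝ) + 1) * (3 / 2 * R * √δ * Module.finrank ℝ E +
        13 / 8 * R ^ 2 * m * trNorm L + 3 / 2 * R * √((K : ℝ) + 1) * trNorm Sig) :=
        mul_le_mul_of_nonneg_left hbound (by positivity)
    _ = 13 / 8 * (trNorm L * (R ^ 2 * m / ((K : ℝ) + 1))) +
        3 / 2 * (R * trNorm Sig * (√((K : ℝ) + 1) / ((K : ℝ) + 1))) +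
        3 / 2 * (√δ * R * Module.finrank ℝ E / ((K : ℝ) + 1)) := by ring
    -- The constants `13/8`, `3/2` and `3/2` are rounded up to `3`.
    _ ≤ 3 * (trNorm L * (R ^ (1 + ν) / ((K : ℝ) + 1) ^ ((1 + ν) / 2))) +
        3 * (R * trNorm Sig * (1 / √((K : ℝ) + 1))) +
        3 * (√δ * R * Module.finrank ℝ E / ((K : ℝ) + 1)) := by
      rw [hrate, hnoise_rate]
      gcongr <;> norm_num
    _ = _ := by ring

theorem mainTheorem1 :
    (∀ (E : Type*) [NormedAddCommGroup E] [InnerProductSpace ℝ E] [FiniteDimensional ℝ E]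
      [MeasurableSpace E] [BorelSpace E]
      (Z : Type*) [MeasurableSpace Z] (D : Measure Z) [IsProbabilityMeasure D]
      (Ω : Type*) [MeasurableSpace Ω] (P : Measure Ω) [IsProbabilityMeasure P]
      (𝓗 : Submodule ℝ (E →ₗ[ℝ] E)) (_ : IsPreconditionerSpace 𝓗)
      (f : E → ℝ) (xstar : E) (_ : ∀ y, f xstar ≤ f y)
      (ν : ℝ) (_ : ν ∈ Set.Icc (0 : ℝ) 1)
      (L : E →ₗ[ℝ] E) (_ : L ∈ 𝓗 ∧ IsPosDefOp L) (_ : IsMatrixHolder f L ν)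
      (gradf : E → E) (_ : ∀ y, IsSubgradientAt f y (gradf y))
      (Sig : E →ₗ[ℝ] E) (_ : Sig ∈ 𝓗 ∧ IsPosDefOp Sig)
      (G : E → Z → E) (_ : IsStochasticGradient D gradf G Sig)
      (K : ℕ) (_ : 1 ≤ K)
      (ξ : ℕ → Ω → Z) (_ : ∀ k ≤ K, Measurable (ξ k) ∧ Measure.map (ξ k) P = D)
      (_ : iIndepFun (fun k : Fin (K + 1) => ξ k) P)
      (δ R : ℝ) (_ : 0 < δ) (_ : 0 < R)
      (x₀ : E) (x : ℕ → Ω → E) (_ : ∀ ω, x 0 ω = x₀)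
      (_ : ∀ ω, IsAdaptiveRun 𝓗 δ R K (fun k => x k ω) (fun k => G (x k ω) (ξ k ω)))
      (_ : ∀ᵐ ω ∂P, ∀ k ≤ K, precNorm 𝓗 (x k ω - xstar) ≤ R),
      Integrable
          (fun ω => f ((1 / ((K : ℝ) + 1)) • ∑ k ∈ Finset.range (K + 1), x k ω) - f xstar) P ∧
        ∫ ω, (f ((1 / ((K : ℝ) + 1)) • ∑ k ∈ Finset.range (K + 1), x k ω) - f xstar) ∂P ≤
          3 * trNorm L * R ^ (1 + ν) / ((K : ℝ) + 1) ^ ((1 + ν) / 2) +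
            3 * trNorm Sig * R / √((K : ℝ) + 1) +
            3 * √δ * R * (Module.finrank ℝ E : ℝ) / ((K : ℝ) + 1)) ∧
    (∀ d : ℕ, IsPreconditionerSpace (adaGradNormSpace d) ∧
      ∀ (δ η : ℝ), 0 < δ → 0 < η → ∀ (K : ℕ) (x g : ℕ → EuclideanSpace ℝ (Fin d)),
        IsAdaptiveRun (adaGradNormSpace d) δ η K x g ↔ IsAdaGradNormRun δ η K x g) ∧
    (∀ d : ℕ, IsPreconditionerSpace (adaGradSpace d) ∧
      ∀ (δ η : ℝ), 0 < δ → 0 < η → ∀ (K : ℕ) (x g : ℕ → EuclideanSpace ℝ (Fin d)),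
        IsAdaptiveRun (adaGradSpace d) δ η K x g ↔ IsAdaGradRun δ η K x g) ∧
    (∀ m n : ℕ, IsPreconditionerSpace (asgoSpace m n) ∧
      ∀ (δ η : ℝ), 0 < δ → 0 < η → ∀ (K : ℕ) (x g : ℕ → MatSpace m n),
        IsAdaptiveRun (asgoSpace m n) δ η K x g ↔ IsASGORun δ η K x g) ∧
    (∀ m n : ℕ, IsPreconditionerSpace (dasgoSpace m n) ∧
      ∀ (δ η : ℝ), 0 < δ → 0 < η → ∀ (K : ℕ) (x g : ℕ → MatSpace m n),
        IsAdaptiveRun (dasgoSpace m n) δ η K x g ↔ IsDASGORun δ η K x g) := by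
  refine ⟨?_, fun d => ⟨?_, fun δ η hδ hη K x g => ?_⟩, fun d => ⟨?_, fun δ η hδ hη K x g => ?_⟩,
    fun m n => ⟨?_, fun δ η hδ hη K x g => ?_⟩, fun m n => ⟨?_, fun δ η hδ hη K x g => ?_⟩⟩
  · intro E _ _ _ _ _ Z _ D _ Ω _ P _ 𝓗 h𝓗 f xstar hmin ν hν L hL hf gradf hgrad Sig hSig G hG K _
      ξ hξ hind δ R hδ hR x₀ x hx₀ hrun hx
    exact h𝓗.integrable_gap_and_integral_gap_le hmin hν hL hf hgrad hSig hG hξ hind hδ hR hx₀ hrun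
      hx
  · exact isPreconditionerSpace_of_mem_iff_diagOp mem_adaGradNormSpace_iff
  · exact isAdaptiveRun_adaGradNormSpace_iff hδ hη K x g
  · exact isPreconditionerSpace_of_mem_iff_diagOp mem_adaGradSpace_iff
  · exact isAdaptiveRun_adaGradSpace_iff hδ hη K x g
  · exact isPreconditionerSpace_asgoSpace m n
  · exact isAdaptiveRun_asgoSpace_iff hδ hη K x g
  · exact isPreconditionerSpace_of_mem_iff_diagOp mem_dasgoSpace_iff
  · exact isAdaptiveRun_dasgoSpace_iff hδ hη K x g
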